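/- Let $A$ be an artin algebra (an algebra that is finitely generated as a module over a commutative artinian ring) with Jacobson radical $J$, and let $M$ be a finitely generated $A$-module which is semilocal, i.e. a direct sum of local modules, where a module $L$ is local if $L/JL$ is simple. The Loewy length of a module $X$ is the least $k$ with $J^kX=0$; let $m$ be the Loewy length of $M$. Let $F$ be a complete set of representatives of the isomorphism classes of indecomposable direct summands of $\bigoplus_{i=1}^{m} M/J^iM$, and put $\widetilde M=\bigoplus_{X\in F}X$. For $0\le i\le m-1$ let $F_i$ be the set of all $X\in F$ of Loewy length $m-i$. For $j\ge 1$ define inductively $F_{i,j}$ to be the set of all $X\in F_i\setminus\bigcup_{1\le k\le j-1}F_{i,k}$ such that for no $N\in F_i\setminus\bigcup_{1\le k\le j-1}F_{i,k}$ is there a surjective homomorphism $X\to N$ lying in the Jacobson radical of the category of $A$-modules (a homomorphism $f:X\to N$ lies in this radical if $1_X-gf$ is invertible for every homomorphism $g:N\to X$). Let $n_i=\min\{j\mid F_i=\bigcup_{1\le k\le j}F_{i,k}\}$ and $n_M=\sum_{i=0}^{m-1}n_i$. Then $$\operatorname{gl.dim}\operatorname{End}_A(\widetilde M)\le n_M .$$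 Here the inequality holds for both the left and the right global dimension. -/

import Mathlib

open scoped DirectSum

universe u v

noncomputable section

namespace ADR

/-- The term `J(A)^k M` of the radical series of an `A`-module `M`, by
`J(A)^0 M = M` and `J(A)^(k+1) M = J(A) (J(A)^k M)`. -/
def radPow (A : Type u) [Ring A] (M : Type v) [AddCommGroup M] [Module A M] :
    ℕ → Submodule A M
  | 0 => ⊤
  | k + 1 => Ring.jacobson A • radPow A M k

/-- A module is local if its top `M / J(A) M` is simple. -/
def IsLocalModule (A : Type u) [Ring A] (M : Type v) [AddCommGroup M] [Module A M] : Prop :=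
  IsSimpleModule A (M ⧸ radPow A M 1)

/-- A module is semilocal if it is a direct sum of local modules. -/
def IsSemilocalModule (A : Type u) [Ring A] (M : Type v) [AddCommGroup M] [Module A M] : Prop :=
  ∃ (ι : Type v) (_ : DecidableEq ι) (L : ι → Submodule A M),
    DirectSum.IsInternal L ∧ ∀ i, IsLocalModule A (L i)

/-- The Loewy length: the least `k` with `J(A)^k M = 0`. -/
def loewyLength (A : Type u) [Ring A] (M : Type v) [AddCommGroup M] [Module A M] : ℕ :=
  sInf {k : ℕ | radPow A M k = ⊥}

/-- A module is indecomposable if it is nonzero and is not the direct sum of two nonzero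
submodules. -/
def IsIndecomposable (A : Type u) [Ring A] (M : Type v) [AddCommGroup M] [Module A M] : Prop :=
  Nontrivial M ∧ ∀ U V : Submodule A M, IsCompl U V → U = ⊥ ∨ V = ⊥

/-- `f : X → Y` lies in the Jacobson radical of the category of `A`-modules:
`1 - g f` is invertible for every `g : Y → X`. -/
def IsRadicalMap {A : Type u} [Ring A] {X Y : Type v} [AddCommGroup X] [Module A X]
    [AddCommGroup Y] [Module A Y] (f : X →ₗ[A] Y) : Prop :=
  ∀ g : Y →ₗ[A] X, IsUnit (1 - g ∘ₗ f : Module.End A X)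

/-- The indecomposable direct summands of a module `N`. -/
def IndecSummand (A : Type u) [Ring A] (N : Type v) [AddCommGroup N] [Module A N] : Type v :=
  {S : Submodule A N // (∃ T : Submodule A N, IsCompl S T) ∧ IsIndecomposable A S}

/-- Isomorphism of indecomposable direct summands. -/
def indecSetoid (A : Type u) [Ring A] (N : Type v) [AddCommGroup N] [Module A N] :
    Setoid (IndecSummand A N) where
  r S T := Nonempty (S.1 ≃ₗ[A] T.1)
  iseqv := ⟨fun _ => ⟨LinearEquiv.refl A _⟩, fun ⟨e⟩ => ⟨e.symm⟩,
    fun ⟨e⟩ ⟨e'⟩ => ⟨e.trans e'⟩⟩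

/-- The isomorphism classes of indecomposable direct summands of `N`. -/
def IndecClass (A : Type u) [Ring A] (N : Type v) [AddCommGroup N] [Module A N] : Type v :=
  Quotient (indecSetoid A N)

/-- A chosen representative of an isomorphism class of indecomposable direct summands. -/
abbrev IndecClass.rep {A : Type u} [Ring A] {N : Type v} [AddCommGroup N] [Module A N]
    (c : IndecClass A N) : Submodule A N :=
  (Quotient.out (s := indecSetoid A N) c).1

/-- The basic module of `N`: the direct sum of one copy of each indecomposable direct summand
of `N`, up to isomorphism. -/
abbrev Basic (A : Type u) [Ring A] (N : Type v) [AddCommGroup N] [Module A N] : Type v :=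
  ⨁ c : IndecClass A N, c.rep

/-- The direct sum of the modules `M / J(A)^i M` for `1 ≤ i ≤ m`, where `m` is the Loewy length
of `M`. -/
abbrev RadQuotientSum (A : Type u) [Ring A] (M : Type v) [AddCommGroup M] [Module A M] :
    Type v :=
  ⨁ i : Fin (loewyLength A M), M ⧸ radPow A M (i + 1)

/-- The module `M̃`. -/
abbrev Tilde (A : Type u) [Ring A] (M : Type v) [AddCommGroup M] [Module A M] : Type v :=
  Basic A (RadQuotientSum A M)

/-- The Auslander-Dlab-Ringel algebra of `M`, with product `g * f = g ∘ f`. -/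
abbrev ADRAlgebra (A : Type u) [Ring A] (M : Type v) [AddCommGroup M] [Module A M] : Type v :=
  Module.End A (Tilde A M)

/-- The set `F` of indecomposable direct summands of `M̃`, up to isomorphism. -/
abbrev Summands (A : Type u) [Ring A] (M : Type v) [AddCommGroup M] [Module A M] : Type v :=
  IndecClass A (RadQuotientSum A M)

/-- `F_i`: the elements of `F` of Loewy length `m - i`. It is used for `i < m` only. -/
def level (A : Type u) [Ring A] (M : Type v) [AddCommGroup M] [Module A M] (i : ℕ) :
    Set (Summands A M) :=
  {X | loewyLength A X.rep = loewyLength A M - i}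

/-- The elements `X` of `S` that have no surjective radical map to an element of `S`. -/
def bottomLayer {A : Type u} [Ring A] {N : Type v} [AddCommGroup N] [Module A N]
    (S : Set (IndecClass A N)) : Set (IndecClass A N) :=
  {X | X ∈ S ∧ ∀ Y ∈ S, ¬ ∃ f : X.rep →ₗ[A] Y.rep, IsRadicalMap f ∧ Function.Surjective f}

/-- `F_{i,1} ∪ ... ∪ F_{i,j}`, where `F_{i,j}` is the bottom layer of
`F_i \ (F_{i,1} ∪ ... ∪ F_{i,j-1})`. -/
def layerUnion (A : Type u) [Ring A] (M : Type v) [AddCommGroup M] [Module A M] (i : ℕ) :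
    ℕ → Set (Summands A M)
  | 0 => ∅
  | j + 1 => layerUnion A M i j ∪ bottomLayer (level A M i \ layerUnion A M i j)

/-- `n_i`: the least `j` with `F_i = F_{i,1} ∪ ... ∪ F_{i,j}`. -/
def layerCount (A : Type u) [Ring A] (M : Type v) [AddCommGroup M] [Module A M] (i : ℕ) : ℕ :=
  sInf {j : ℕ | level A M i = layerUnion A M i j}

/-- `n_M`: the sum of the `n_i` for `0 ≤ i ≤ m - 1`. -/
def layerNumber (A : Type u) [Ring A] (M : Type v) [AddCommGroup M] [Module A M] : ℕ :=
  ∑ i ∈ Finset.range (loewyLength A M), layerCount A M i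

/-- The left global dimension of a ring: the supremum of the projective dimensions of its left
modules. -/
def leftGlobalDim (B : Type v) [Ring B] : WithBot ℕ∞ :=
  ⨆ N : ModuleCat.{v} B, CategoryTheory.projectiveDimension N

/-- The right global dimension of a ring; right modules are left modules over the opposite
ring. -/
def rightGlobalDim (B : Type v) [Ring B] : WithBot ℕ∞ :=
  leftGlobalDim Bᵐᵒᵖ

end ADR

end

/-! Order the layers `F_{i,j}` lexicographically, so that Loewy length decreases as the layer rises.
By Krull-Schmidt the members of `F` are the radical quotients of the local summands of `M`; they are
local, and `F` is closed under quotients by powers of `J`. For `X` in `F` of Loewy length `k + 1 >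
1`, let `η` be the projection from `X` onto its reflection `X' = X/J^k X`, which lies in a higher
layer; for `k = 0` put `X' = 0`. The key fact (`IsLayering.bijective_or_le_ker`) is that a
non-bijective map `X → Y` into a layer that is not lower kills `J^k X`, hence factors through `η`.

In `B = End(M̃)` this says (`IsLayered`): `B e_{X'}` embeds in `B e_X` by right multiplication by
`η`, and the image contains every non-isomorphism from `X` to a layer that is not lower. If a simple
left module `S` has `X` as a highest layer on which it does not vanish, the kernel of `B e_X → S` is
therefore an extension, by the projective `B e_{X'}`, of a module living on strictly lower layers.
Induction on the layers bounds the projective dimension of every left module.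

For right modules, the same data make `X'` reduce generators instead. Modules inside free modules
remember that `η` is epi (`DetectsCorner`), and the kernel of a minimal cover of such a module
generated from layers `≥ k` is generated from layers `≥ k + 1` (`IsColayered.generatedFrom_ker`).
The syzygies thus run out of layers. -/

noncomputable section

namespace ADR

open CategoryTheory

/-! ### Projective dimension in short exact sequences and direct sums. -/

section ProjectiveDimension

variable {B : Type v} [Ring B]

/-- The projective dimension of the `B`-module `N` is less than `n`. -/
abbrev PdLT (B : Type v) [Ring B] (N : Type v) [AddCommGroup N] [Module B N] (n : ℕ) : Prop :=
  HasProjectiveDimensionLT (ModuleCat.of B N) n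

variable {N N' N'' : Type v} [AddCommGroup N] [Module B N] [AddCommGroup N'] [Module B N']
  [AddCommGroup N''] [Module B N'']

theorem PdLT.mono {m n : ℕ} (h : PdLT B N m) (hmn : m ≤ n) : PdLT B N n :=
  hasProjectiveDimensionLT_of_ge _ m n hmn

theorem PdLT.of_equiv {n : ℕ} (e : N ≃ₗ[B] N') (h : PdLT B N n) : PdLT B N' n :=
  hasProjectiveDimensionLT_of_iso e.toModuleIso n

theorem pdLT_of_subsingleton [Subsingleton N] (n : ℕ) : PdLT B N n :=
  have : HasProjectiveDimensionLT (ModuleCat.of B N) 0 :=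
    (ModuleCat.isZero_of_subsingleton (ModuleCat.of B N)).hasProjectiveDimensionLT_zero
  PdLT.mono this n.zero_le

theorem subsingleton_of_pdLT_zero (h : PdLT B N 0) : Subsingleton N :=
  ModuleCat.subsingleton_of_isZero ((hasProjectiveDimensionLT_zero_iff_isZero _).1 h)

theorem pdLT_one_iff : PdLT B N 1 ↔ Module.Projective B N := by
  rw [IsProjective.iff_projective, projective_iff_hasProjectiveDimensionLT_one]

theorem PdLT.ker {f : N →ₗ[B] N'} (hf : Function.Surjective f) {n : ℕ}
    (h : PdLT B N n) (h' : PdLT B N' (n + 1)) : PdLT B (LinearMap.ker f) n :=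
  (LinearMap.shortExact_shortComplexKer hf).hasProjectiveDimensionLT_X₁ n h h'

theorem PdLT.of_ker {f : N →ₗ[B] N'} (hf : Function.Surjective f) {n : ℕ}
    (h : PdLT B (LinearMap.ker f) n) (h' : PdLT B N (n + 1)) : PdLT B N' (n + 1) :=
  (LinearMap.shortExact_shortComplexKer hf).hasProjectiveDimensionLT_X₃ n h h'

theorem PdLT.of_submodule_quotient (S : Submodule B N) {n : ℕ}
    (h : PdLT B S n) (h' : PdLT B (N ⧸ S) n) : PdLT B N n := by
  refine (LinearMap.shortExact_shortComplexKer S.mkQ_surjective).hasProjectiveDimensionLT_X₂ n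
    ?_ h'
  exact PdLT.of_equiv (LinearEquiv.ofEq _ _ S.ker_mkQ.symm) h

/-- The kernel of a direct sum of linear maps is the direct sum of the kernels. -/
def directSumKerEquiv {ι : Type v} {P S : ι → Type v} [∀ i, AddCommGroup (P i)]
    [∀ i, Module B (P i)] [∀ i, AddCommGroup (S i)] [∀ i, Module B (S i)]
    (p : ∀ i, P i →ₗ[B] S i) :
    (⨁ i, LinearMap.ker (p i)) ≃ₗ[B] LinearMap.ker (DirectSum.lmap p) :=
  (LinearEquiv.ofInjective (DirectSum.lmap fun i ↦ (LinearMap.ker (p i)).subtype)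
    ((DirectSum.lmap_injective _).2 fun _ ↦ Subtype.val_injective)).trans
    (LinearEquiv.ofEq _ _ (by
      classical
      ext x
      rw [DirectSum.ker_lmap, DirectSum.range_lmap]
      simp))

/-- Dimension shifting along free covers of the summands. Infinite index sets are needed, since the
semisimple modules met later may have infinitely many summands. -/
theorem PdLT.directSum {ι : Type v} (S : ι → Type v) [∀ i, AddCommGroup (S i)]
    [∀ i, Module B (S i)] {n : ℕ} (h : ∀ i, PdLT B (S i) n) : PdLT B (⨁ i, S i) n := by
  induction n generalizing S with
  | zero =>
    have := fun i ↦ subsingleton_of_pdLT_zero (h i)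
    have : Subsingleton (⨁ i, S i) := ⟨fun a b ↦ DFinsupp.ext fun i ↦ Subsingleton.elim _ _⟩
    exact pdLT_of_subsingleton 0
  | succ n ih =>
    -- The bound `1` is projectivity itself: there a free cover does not satisfy the bound `0` that
    -- shifting would require.
    rcases n with _ | n
    · have := fun i ↦ pdLT_one_iff.1 (h i)
      exact pdLT_one_iff.2 inferInstance
    have key (P : ι → ModuleCat.{v} B) [∀ i, Module.Projective B (P i)]
        (p : ∀ i, P i →ₗ[B] S i) (hp : ∀ i, Function.Surjective (p i)) :
        PdLT B (⨁ i, S i) (n + 1 + 1) :=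
      PdLT.of_ker ((DirectSum.lmap_surjective p).2 hp)
        ((ih _ fun i ↦ PdLT.ker (hp i) ((pdLT_one_iff.2 inferInstance).mono (by omega))
          (h i)).of_equiv (directSumKerEquiv p))
        ((pdLT_one_iff.2 inferInstance).mono (by omega))
    have (i : ι) : Module.Projective B (ModuleCat.of B (S i →₀ B)) :=
      inferInstanceAs (Module.Projective B (S i →₀ B))
    exact key (fun i ↦ ModuleCat.of B (S i →₀ B)) (fun i ↦ Finsupp.linearCombination B id)
      fun i s ↦ ⟨Finsupp.single s 1, by simp⟩

end ProjectiveDimension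

/-! ### Left modules over a ring with layered idempotents. -/

section Layered

variable {B : Type v} [Ring B] {F : Type v} [Fintype F]

/-- A complete family of orthogonal idempotents `e x`, arranged in layers, such that every `e x`
has a reflection `η x` from `x` to a higher layer: `η x` is right cancellable on the corner `f x`,
and every element from `x` to a layer which is not lower is either invertible or factors through
`η x`. -/
structure IsLayered (e : F → B) (lev : F → ℕ) (η f : F → B) : Prop
    extends CompleteOrthogonalIdempotents e where
  corner : ∀ x, f x = 0 ∨ ∃ y, lev x < lev y ∧ f x = e y
  corner_mul : ∀ x, f x * η x = η x
  mul_idem : ∀ x, η x * e x = η x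
  cancel : ∀ x b, b * η x = 0 → b * f x = 0
  factor : ∀ x y b, lev x ≤ lev y → e y * b * e x = b →
    (y = x ∧ ∃ c, c * b = e x ∧ b * c = e x) ∨ ∃ c, b = c * η x

/-- The idempotents of the layers `≥ k` annihilate `N`. -/
def VanishesFrom (e : F → B) (lev : F → ℕ) (k : ℕ) (N : Type v) [AddCommGroup N]
    [Module B N] : Prop :=
  ∀ y, k ≤ lev y → ∀ v : N, e y • v = 0

omit [Fintype F] in
theorem VanishesFrom.of_injective {e : F → B} {lev : F → ℕ} {k : ℕ} {N N' : Type v}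
    [AddCommGroup N] [Module B N] [AddCommGroup N'] [Module B N']
    (h : VanishesFrom e lev k N) (g : N' →ₗ[B] N) (hg : Function.Injective g) :
    VanishesFrom e lev k N' := fun y hy v ↦ hg (by simp [h y hy])

omit [Fintype F] in
theorem VanishesFrom.of_surjective {e : F → B} {lev : F → ℕ} {k : ℕ} {N N' : Type v}
    [AddCommGroup N] [Module B N] [AddCommGroup N'] [Module B N']
    (h : VanishesFrom e lev k N) (g : N →ₗ[B] N') (hg : Function.Surjective g) :
    VanishesFrom e lev k N' := fun y hy v ↦ by
  obtain ⟨w, rfl⟩ := hg v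
  rw [← map_smul, h y hy, map_zero]

theorem projective_span_idempotent {a : B} (ha : a * a = a) :
    Module.Projective B (Submodule.span B {a}) := by
  refine Module.Projective.of_split (Submodule.subtype _)
    ((LinearMap.toSpanSingleton B B a).codRestrict _ fun b ↦
      Submodule.mem_span_singleton.2 ⟨b, rfl⟩) ?_
  ext ⟨b, hb⟩
  obtain ⟨c, rfl⟩ := Submodule.mem_span_singleton.1 hb
  simp [mul_assoc, ha]

namespace IsLayered

variable {e : F → B} {lev : F → ℕ} {η f : F → B}

theorem corner_idem (h : IsLayered e lev η f) (x : F) : f x * f x = f x := by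
  obtain h0 | ⟨y, -, h0⟩ := h.corner x <;> rw [h0]
  · simp
  · exact h.idem y

theorem smul_ext (h : IsLayered e lev η f) {N : Type v} [AddCommGroup N] [Module B N] (v : N) :
    ∑ x, e x • v = v := by
  rw [← Finset.sum_smul, h.complete, one_smul]

/-- The kernel of the cover `B e x → S` contains a copy of the projective `B f x`, and the quotient
of the kernel by it vanishes from layer `k` on, so `ih` applies. -/
theorem pdLT_of_simple (h : IsLayered e lev η f) {k : ℕ}
    (ih : ∀ (N : Type v) [AddCommGroup N] [Module B N], VanishesFrom e lev k N →
      PdLT B N (k + 1))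
    (S : Type v) [AddCommGroup S] [Module B S] [IsSimpleModule B S]
    (hS : VanishesFrom e lev (k + 1) S) : PdLT B S (k + 2) := by
  by_cases hk : VanishesFrom e lev k S
  · exact (ih S hk).mono (by omega)
  unfold VanishesFrom at hk
  push Not at hk
  obtain ⟨x, hx, s₀, hs₀⟩ := hk
  have hxk : lev x = k := by
    by_contra hne
    exact hs₀ (hS x (by omega) s₀)
  set s := e x • s₀ with hs
  have hes : e x • s = s := by rw [hs, smul_smul, h.idem x]
  have hηs : η x • s = 0 := by
    rw [← h.corner_mul x, mul_smul]
    obtain h0 | ⟨y, hy, h0⟩ := h.corner x <;> rw [h0]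
    · simp
    · exact hS y (by omega) _
  let π : Submodule.span B {e x} →ₗ[B] S :=
    (LinearMap.toSpanSingleton B S s).domRestrict _
  have hπ : Function.Surjective π := fun t ↦ by
    obtain ⟨b, hb⟩ := IsSimpleModule.toSpanSingleton_surjective B hs₀ t
    refine ⟨⟨b • e x, Submodule.mem_span_singleton.2 ⟨b, rfl⟩⟩, ?_⟩
    simpa [π, mul_smul, hes] using hb
  have hP : PdLT B (Submodule.span B {e x}) (k + 2) :=
    (pdLT_one_iff.2 (projective_span_idempotent (h.idem x))).mono (by omega)
  refine PdLT.of_ker hπ ?_ hP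
  -- Right multiplication by `η x`; it lands in the kernel because `f x`, and so `η x`, kills `s`.
  let g₀ : Submodule.span B {f x} →ₗ[B] Submodule.span B {e x} :=
    ((LinearMap.toSpanSingleton B B (η x)).domRestrict _).codRestrict _ fun b ↦
      Submodule.mem_span_singleton.2 ⟨b.1 * η x, by simp [mul_assoc, h.mul_idem]⟩
  let g : Submodule.span B {f x} →ₗ[B] LinearMap.ker π := g₀.codRestrict _ fun b ↦ by
    simp [π, g₀, mul_smul, hηs]
  have hg_apply (b) : ((g b).1 : B) = b.1 * η x := rfl
  have hg : Function.Injective g := by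
    rw [injective_iff_map_eq_zero]
    rintro ⟨b, hb⟩ hb0
    obtain ⟨c, rfl⟩ := Submodule.mem_span_singleton.1 hb
    have := h.cancel x (c * f x) (congr_arg (fun t ↦ (t.1 : B)) hb0 :)
    rw [mul_assoc, h.corner_idem] at this
    exact Subtype.ext this
  refine PdLT.of_submodule_quotient (LinearMap.range g)
    (((pdLT_one_iff.2 (projective_span_idempotent (h.corner_idem x))).mono (by omega)).of_equiv
      (LinearEquiv.ofInjective g hg)) (ih _ ?_)
  intro y hy q
  obtain ⟨b, rfl⟩ := Submodule.mkQ_surjective _ q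
  obtain ⟨⟨b, hb⟩, hbs⟩ := b
  rw [← map_smul, Submodule.mkQ_apply, Submodule.Quotient.mk_eq_zero]
  obtain ⟨c, rfl⟩ := Submodule.mem_span_singleton.1 hb
  have hcs : c • s = 0 := by
    have : (c • e x) • s = 0 := hbs
    rwa [smul_assoc, hes] at this
  -- An invertible element of the corner cannot kill `s ≠ 0`, so `e y * c * e x` is a multiple of `η
  -- x`, that is, in the image of `g`.
  obtain ⟨-, d, hd, -⟩ | ⟨d, hd⟩ := h.factor x y (e y * c * e x) (by omega) (by
    rw [mul_assoc (e y) _ (e x), mul_assoc (e y * c), (h.idem x).eq, ← mul_assoc, ← mul_assoc,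
      (h.idem y).eq])
  · exfalso
    apply hs₀
    calc s = e x • s := hes.symm
      _ = 0 := by rw [← hd, mul_smul, mul_smul, mul_smul, hes, hcs, smul_zero, smul_zero]
  · refine ⟨⟨d • f x, Submodule.mem_span_singleton.2 ⟨d, rfl⟩⟩, ?_⟩
    apply Subtype.ext
    apply Subtype.ext
    rw [hg_apply]
    simp only [smul_eq_mul, mul_assoc, h.corner_mul]
    rw [← hd]
    simp [mul_assoc]

/-- The nilpotent radical filters any module with semisimple factors, and vanishing passes to
submodules and quotients, so simple modules suffice. -/
theorem pdLT_of_vanishesFrom [IsSemiprimaryRing B] (h : IsLayered e lev η f) (k : ℕ) :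
    ∀ (N : Type v) [AddCommGroup N] [Module B N], VanishesFrom e lev k N → PdLT B N (k + 1) := by
  induction k with
  | zero =>
    intro N _ _ hN
    have : Subsingleton N := subsingleton_of_forall_eq 0 fun v ↦ by
      rw [← h.smul_ext v]
      exact Finset.sum_eq_zero fun y _ ↦ hN y (Nat.zero_le _) v
    exact pdLT_of_subsingleton _
  | succ k ih =>
    intro N _ _
    refine IsSemiprimaryRing.induction ℤ B N
      (P := fun M _ _ _ ↦ VanishesFrom e lev (k + 1) M → PdLT B M (k + 2))
      (fun M _ _ _ _ _ _ hM ↦ ?_) (fun M _ _ _ _ h₁ h₂ hM ↦ ?_)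
    · obtain ⟨s, ε, -, hs⟩ := IsSemisimpleModule.exists_linearEquiv_dfinsupp B M
      refine PdLT.of_equiv ε.symm (PdLT.directSum _ fun m ↦ ?_)
      have := hs m
      exact h.pdLT_of_simple ih _ (hM.of_injective m.1.subtype Subtype.val_injective)
    · exact PdLT.of_submodule_quotient _
        (h₁ (hM.of_injective _ (Submodule.subtype_injective _)))
        (h₂ (hM.of_surjective _ (Submodule.mkQ_surjective _)))

theorem leftGlobalDim_le [IsSemiprimaryRing B] (h : IsLayered e lev η f) {n : ℕ}
    (hn : ∀ x, lev x < n) : leftGlobalDim B ≤ n := by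
  refine iSup_le fun N ↦ (CategoryTheory.projectiveDimension_le_iff N n).2 ?_
  exact h.pdLT_of_vanishesFrom n N fun y hy ↦ absurd (hn y) (by omega)

end IsLayered

end Layered

/-- Nakayama without finite generation, thanks to the nilpotent radical. -/
theorem eq_top_of_sup_jacobson_smul_eq_top {C : Type u} [Ring C] [IsSemiprimaryRing C] {N : Type v}
    [AddCommGroup N] [Module C N] (S : Submodule C N)
    (h : S ⊔ Ring.jacobson C • (⊤ : Submodule C N) = ⊤) : S = ⊤ := by
  obtain ⟨n, hn⟩ := IsSemiprimaryRing.isNilpotent (R := C)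
  have key (k : ℕ) : S ⊔ (Ring.jacobson C) ^ k • (⊤ : Submodule C N) = ⊤ := by
    induction k with
    | zero => rw [Submodule.pow_zero, Ideal.one_eq_top, Submodule.top_smul, sup_top_eq]
    | succ k ih =>
      rw [eq_top_iff]
      calc ⊤ = S ⊔ Ring.jacobson C ^ k • (S ⊔ Ring.jacobson C • (⊤ : Submodule C N)) := by
            rw [h, ih]
        _ ≤ _ := by
            rw [Submodule.smul_sup, Submodule.pow_succ, Submodule.mul_smul]
            exact sup_le le_sup_left (sup_le_sup_right Submodule.smul_le_right _)
  simpa [hn] using key n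

/-! ### The opposite ring: syzygies generated from ever higher layers. -/

section Colayered

variable {C : Type v} [Ring C] {F : Type v} [Fintype F]

/-- The notion dual to `IsLayered`. -/
structure IsColayered (e : F → C) (lev : F → ℕ) (η f : F → C) : Prop
    extends CompleteOrthogonalIdempotents e where
  corner : ∀ x, f x = 0 ∨ ∃ y, lev x < lev y ∧ f x = e y
  mul_corner : ∀ x, η x * f x = η x
  idem_mul : ∀ x, e x * η x = η x
  cancel : ∀ x b, η x * b = 0 → f x * b = 0
  factor : ∀ x y b, lev x ≤ lev y → e x * b * e y = b →
    (y = x ∧ ∃ c, c * b = e x ∧ b * c = e x) ∨ ∃ c, b = η x * c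

theorem IsLayered.op {e : F → C} {lev : F → ℕ} {η f : F → C} (h : IsLayered e lev η f) :
    IsColayered (fun x ↦ MulOpposite.op (e x)) lev (fun x ↦ MulOpposite.op (η x))
      (fun x ↦ MulOpposite.op (f x)) where
  idem x := by
    rw [IsIdempotentElem, ← MulOpposite.op_mul, (h.idem x).eq]
  ortho x y hxy := by
    change _ * _ = _
    rw [← MulOpposite.op_mul, h.ortho hxy.symm, MulOpposite.op_zero]
  complete := by
    rw [← MulOpposite.op_one, ← h.complete, Finset.op_sum]
  corner x := by
    obtain h0 | ⟨y, hy, h0⟩ := h.corner x <;> rw [h0]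
    · exact Or.inl rfl
    · exact Or.inr ⟨y, hy, rfl⟩
  mul_corner x := by rw [← MulOpposite.op_mul, h.corner_mul]
  idem_mul x := by rw [← MulOpposite.op_mul, h.mul_idem]
  cancel x b hb := MulOpposite.unop_injective (h.cancel x b.unop (congr_arg MulOpposite.unop hb))
  factor x y b hxy hb := by
    obtain ⟨rfl, c, h₁, h₂⟩ | ⟨c, hc⟩ := h.factor x y b.unop hxy (by
      rw [mul_assoc]; exact congr_arg MulOpposite.unop hb)
    · exact Or.inl ⟨rfl, MulOpposite.op c, MulOpposite.unop_injective h₂,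
        MulOpposite.unop_injective h₁⟩
    · exact Or.inr ⟨MulOpposite.op c, MulOpposite.unop_injective hc⟩

theorem isSemisimpleModule_quotient_jacobson_smul [IsSemiprimaryRing C] (N : Type v)
    [AddCommGroup N] [Module C N] :
    IsSemisimpleModule C (N ⧸ (Ring.jacobson C • ⊤ : Submodule C N)) := by
  have h : Module.IsTorsionBySet C (N ⧸ (Ring.jacobson C • ⊤ : Submodule C N))
      (Ring.jacobson C) :=
    (Module.isTorsionBySet_quotient_iff _ _).2 fun m i hi ↦
      Submodule.smul_mem_smul hi trivial
  let _ := h.module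
  exact (h.semilinearMap.isSemisimpleModule_iff_of_bijective Function.bijective_id).2
    inferInstance

/-- `N` is generated by the idempotents of the layers `≥ k`. -/
def GeneratedFrom (e : F → C) (lev : F → ℕ) (k : ℕ) (N : Type v) [AddCommGroup N]
    [Module C N] : Prop :=
  Submodule.span C {v : N | ∃ y, k ≤ lev y ∧ e y • v = v} = ⊤

omit [Fintype F] in
theorem GeneratedFrom.of_surjective {e : F → C} {lev : F → ℕ} {k : ℕ} {N N' : Type v}
    [AddCommGroup N] [Module C N] [AddCommGroup N'] [Module C N']
    (h : GeneratedFrom e lev k N) (g : N →ₗ[C] N') (hg : Function.Surjective g) :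
    GeneratedFrom e lev k N' := by
  rw [GeneratedFrom, eq_top_iff, ← LinearMap.range_eq_top.2 hg, LinearMap.range_eq_map, ← h,
    Submodule.map_span]
  refine Submodule.span_mono ?_
  rintro _ ⟨v, ⟨y, hy, hv⟩, rfl⟩
  exact ⟨y, hy, by rw [← map_smul, hv]⟩

omit [Fintype F] in
theorem GeneratedFrom.exists_ne_zero {e : F → C} {lev : F → ℕ} {k : ℕ} {N : Type v}
    [AddCommGroup N] [Module C N] [Nontrivial N] (h : GeneratedFrom e lev k N) :
    ∃ y, ∃ v : N, k ≤ lev y ∧ e y • v = v ∧ v ≠ 0 := by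
  by_contra! hcon
  have : (⊤ : Submodule C N) = ⊥ := by
    rw [← h, Submodule.span_eq_bot]
    rintro v ⟨y, hy, hv⟩
    exact hcon y v hy hv
  exact top_ne_bot this

omit [Fintype F] in
/-- A minimal system of generators, each of which lies in a corner of a layer `≥ k`. -/
theorem GeneratedFrom.exists_minimal_generators [IsSemiprimaryRing C] {e : F → C} {lev : F → ℕ}
    (he : ∀ x, e x * e x = e x) {k : ℕ} {N : Type v} [AddCommGroup N] [Module C N]
    (h : GeneratedFrom e lev k N) :
    ∃ (ι : Type v) (x : ι → F) (v : ι → N), (∀ i, k ≤ lev (x i)) ∧ (∀ i, e (x i) • v i = v i) ∧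
      Submodule.span C (Set.range v) = ⊤ ∧
      ∀ φ : ι →₀ C, Finsupp.linearCombination C v φ = 0 → ∀ i c, c * φ i ≠ e (x i) := by
  classical
  have := isSemisimpleModule_quotient_jacobson_smul (C := C) N
  obtain ⟨s, ε, -, hs⟩ := IsSemisimpleModule.exists_linearEquiv_dfinsupp C
    (N ⧸ (Ring.jacobson C • ⊤ : Submodule C N))
  -- Each simple summand of the top of `N` is a quotient of `N`, so it is again generated from
  -- layers `≥ k`. The generators of `N` are lifts of the chosen `w`.
  have hy (m : s) : ∃ y, ∃ w : m.1, k ≤ lev y ∧ e y • w = w ∧ w ≠ 0 := by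
    have := hs m
    have := IsSimpleModule.nontrivial C m.1
    refine GeneratedFrom.exists_ne_zero (h.of_surjective
      ((DFinsupp.lapply m ∘ₗ ε.toLinearMap) ∘ₗ Submodule.mkQ _) ?_)
    refine Function.Surjective.comp (g := DFinsupp.lapply m ∘ₗ ε.toLinearMap) ?_
      (Submodule.mkQ_surjective _)
    refine Function.Surjective.comp (g := DFinsupp.lapply (R := C) m) (fun w ↦ ?_) ε.surjective
    exact ⟨DFinsupp.single m w, by simp⟩
  choose x w hx hw hw0 using hy
  let q : N →ₗ[C] Π₀ m : s, m.1 := ε.toLinearMap ∘ₗ Submodule.mkQ _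
  have hq : Function.Surjective q := ε.surjective.comp (Submodule.mkQ_surjective _)
  choose v₀ hv₀ using fun m ↦ hq (DFinsupp.single m (w m))
  have hv (m : s) : q (e (x m) • v₀ m) = DFinsupp.single m (w m) := by
    rw [map_smul, hv₀, ← DFinsupp.single_smul, hw]
  refine ⟨s, x, fun m ↦ e (x m) • v₀ m, hx, fun m ↦ by rw [smul_smul, he], ?_, ?_⟩
  · apply eq_top_of_sup_jacobson_smul_eq_top
    rw [sup_comm, ← Submodule.map_mkQ_eq_top]
    have : Submodule.map q (Submodule.span C (Set.range fun m ↦ e (x m) • v₀ m)) = ⊤ := by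
      rw [eq_top_iff]
      rintro z -
      induction z using DFinsupp.induction with
      | h0 => exact zero_mem _
      | ha m b z _ _ hz =>
        refine add_mem ?_ hz
        have := hs m
        obtain ⟨a, rfl⟩ := IsSimpleModule.toSpanSingleton_surjective C (hw0 m) b
        refine ⟨a • e (x m) • v₀ m, Submodule.smul_mem _ _ (Submodule.subset_span ⟨m, rfl⟩), ?_⟩
        rw [map_smul, hv, ← DFinsupp.single_smul]
        rfl
    rw [Submodule.map_comp] at this
    exact Submodule.map_injective_of_injective ε.injective
      (this.trans (by rw [Submodule.map_top, LinearEquiv.range]))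
  · intro φ hφ m c hc
    -- Reduce the relation to the top of `N` and read off its component in the `m`-th simple
    -- summand.
    have h1 : φ m • w m = 0 := by
      have := congr_arg (DFinsupp.lapply (R := C) m ∘ₗ q) hφ
      rw [map_zero, Finsupp.apply_linearCombination, Finsupp.linearCombination_apply,
        Finsupp.sum_eq_single m] at this
      · simpa [hv] using this
      · intro i _ hi
        simp [hv, DFinsupp.single_eq_of_ne hi.symm]
      · simp
    apply hw0 m
    rw [← hw m, ← hc, mul_smul, h1, smul_zero]

/-- Annihilation by `η x` can be detected on the corner `f x`. -/
def DetectsCorner (η f : F → C) (N : Type v) [AddCommGroup N] [Module C N] : Prop :=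
  ∀ x, ∀ v : N, η x • v = 0 → f x • v = 0

omit [Fintype F] in
theorem DetectsCorner.of_injective {η f : F → C} {N N' : Type v} [AddCommGroup N] [Module C N]
    [AddCommGroup N'] [Module C N'] (h : DetectsCorner η f N) (g : N' →ₗ[C] N)
    (hg : Function.Injective g) : DetectsCorner η f N' := fun x v hv ↦ by
  apply hg
  rw [map_smul, h x _ (by rw [← map_smul, hv, map_zero]), map_zero]

namespace IsColayered

variable {e : F → C} {lev : F → ℕ} {η f : F → C}

theorem smul_ext (h : IsColayered e lev η f) {N : Type v} [AddCommGroup N] [Module C N] (v : N) :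
    ∑ x, e x • v = v := by
  rw [← Finset.sum_smul, h.complete, one_smul]

/-- `cancel` in each coordinate. The property passes to submodules, hence holds for all syzygies. -/
theorem detectsCorner_finsupp (h : IsColayered e lev η f) (ι : Type v) :
    DetectsCorner η f (ι →₀ C) := fun x v hv ↦ by
  ext i
  exact h.cancel x _ (DFunLike.congr_fun hv i)

theorem corner_idem (h : IsColayered e lev η f) (x : F) : f x * f x = f x := by
  obtain h0 | ⟨y, -, h0⟩ := h.corner x <;> rw [h0]
  · simp
  · exact h.idem y

omit [Fintype F] in
/-- The direct sum of the projective modules `C e (x i)`, as a submodule of a free module. -/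
theorem exists_projective_cornerSum (he : ∀ x, e x * e x = e x) {ι : Type v} (x : ι → F) :
    ∃ (P : Type v) (_ : AddCommGroup P) (_ : Module C P) (j : P →ₗ[C] ι →₀ C),
      Module.Projective C P ∧ Function.Injective j ∧
      ∀ φ, φ ∈ LinearMap.range j ↔ ∀ i, φ i * e (x i) = φ i := by
  let S : Submodule C (ι →₀ C) :=
    { carrier := {φ | ∀ i, φ i * e (x i) = φ i}
      add_mem' := fun {φ ψ} hφ hψ i ↦ by rw [Finsupp.add_apply, add_mul, hφ i, hψ i]
      zero_mem' := fun i ↦ by simp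
      smul_mem' := fun c φ hφ i ↦ by rw [Finsupp.smul_apply, smul_eq_mul, mul_assoc, hφ i] }
  -- Right multiplication by `e (x i)` in coordinate `i`, a retraction onto `S`.
  let t : (ι →₀ C) →ₗ[C] (ι →₀ C) :=
    Finsupp.linearCombination C fun i ↦ Finsupp.single i (e (x i))
  have ht (φ i) : t φ i = φ i * e (x i) := by
    classical
    rw [Finsupp.linearCombination_apply, Finsupp.sum_apply, Finsupp.sum_eq_single i]
    · simp
    · intro k _ hk
      simp [hk]
    · simp
  refine ⟨S, inferInstance, inferInstance, S.subtype, ?_, Subtype.val_injective, fun φ ↦ ?_⟩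
  · refine Module.Projective.of_split S.subtype (t.codRestrict S fun φ i ↦ ?_) ?_
    · rw [ht, mul_assoc, he]
    · ext φ i
      exact (ht φ.1 i).trans (φ.2 i)
  · rw [Submodule.range_subtype]
    rfl

/-- For `lev y ≤ k`, minimality excludes invertible coordinates of `e y • φ`, so `e y • φ = η y • ψ`
with `ψ` in the corner `f y`. Since `N` detects corners, `ψ` is in the kernel too, and it lives in a
higher layer. -/
theorem generatedFrom_ker (h : IsColayered e lev η f) {k : ℕ} {N P : Type v} [AddCommGroup N]
    [Module C N] [AddCommGroup P] [Module C P] (hN : DetectsCorner η f N) {ι : Type v}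
    {x : ι → F} (hx : ∀ i, k ≤ lev (x i)) (j : P →ₗ[C] ι →₀ C) (hj : Function.Injective j)
    (hj' : ∀ φ, φ ∈ LinearMap.range j ↔ ∀ i, φ i * e (x i) = φ i) (π : P →ₗ[C] N)
    (hmin : ∀ φ, π φ = 0 → ∀ i c, c * j φ i ≠ e (x i)) :
    GeneratedFrom e lev (k + 1) (LinearMap.ker π) := by
  classical
  set K' := Submodule.span C {v : LinearMap.ker π | ∃ y, k + 1 ≤ lev y ∧ e y • v = v} with hK'
  -- Descending induction on the layer: `d` bounds the distance of `y` from layer `k + 1`.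
  have step (d : ℕ) : ∀ y, k + 1 ≤ lev y + d → ∀ φ : LinearMap.ker π, e y • φ ∈ K' := by
    induction d with
    | zero =>
      exact fun y hy φ ↦ Submodule.subset_span ⟨y, hy, by rw [smul_smul, h.idem y]⟩
    | succ d ih =>
      intro y hy φ
      by_cases hy' : k + 1 ≤ lev y
      · exact Submodule.subset_span ⟨y, hy', by rw [smul_smul, h.idem y]⟩
      have hφ : ∀ i, j φ.1 i * e (x i) = j φ.1 i := (hj' _).1 ⟨φ.1, rfl⟩
      have hfac (i) : ∃ c, e y * j φ.1 i = η y * c := by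
        obtain ⟨hxy, c, hc, -⟩ | hc := h.factor y (x i) (e y * j φ.1 i)
          (by have := hx i; omega)
          (by rw [← mul_assoc, (h.idem y).eq, mul_assoc, hφ])
        · have := hmin (e y • φ.1) (by rw [map_smul, φ.2, smul_zero]) i c
          rw [map_smul, hxy] at this
          exact absurd hc this
        · exact hc
      choose c hc using hfac
      -- The case distinction keeps the support finite: `c i` is arbitrary where `j φ.1 i` vanishes.
      let ψ₀ : ι →₀ C := Finsupp.onFinset (j φ.1).support
        (fun i ↦ if j φ.1 i = 0 then 0 else f y * c i * e (x i)) fun i hi ↦ by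
          rw [Finsupp.mem_support_iff]
          exact fun h0 ↦ hi (if_pos h0)
      have hψ₀ (i) : ψ₀ i = if j φ.1 i = 0 then 0 else f y * c i * e (x i) := rfl
      obtain ⟨ψ, hψ⟩ := (hj' ψ₀).2 fun i ↦ by
        rw [hψ₀]
        split_ifs
        · simp
        · rw [mul_assoc, (h.idem _).eq]
      have hηψ : e y • φ.1 = η y • ψ := by
        apply hj
        rw [map_smul, map_smul, hψ]
        ext i
        rw [Finsupp.smul_apply, Finsupp.smul_apply, hψ₀, smul_eq_mul, smul_eq_mul]
        split_ifs with h0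
        · simp [h0]
        · rw [← mul_assoc, ← mul_assoc, h.mul_corner, ← hc, mul_assoc, hφ]
      have hfψ : f y • ψ = ψ := by
        apply hj
        rw [map_smul, hψ]
        ext i
        rw [Finsupp.smul_apply, hψ₀, smul_eq_mul]
        split_ifs
        · simp
        · rw [← mul_assoc, ← mul_assoc, h.corner_idem]
      have hπψ : π ψ = 0 := by
        rw [← hfψ, map_smul]
        apply hN
        rw [← map_smul, ← hηψ, map_smul, φ.2, smul_zero]
      have hmem : (⟨ψ, hπψ⟩ : LinearMap.ker π) ∈ K' := by
        have hψ' : f y • (⟨ψ, hπψ⟩ : LinearMap.ker π) = ⟨ψ, hπψ⟩ := Subtype.ext hfψ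
        rw [← hψ']
        obtain h0 | ⟨y', hyy', h0⟩ := h.corner y <;> rw [h0]
        · rw [zero_smul]
          exact zero_mem _
        · exact ih y' (by omega) _
      have : e y • φ = η y • (⟨ψ, hπψ⟩ : LinearMap.ker π) := Subtype.ext hηψ
      rw [this]
      exact Submodule.smul_mem _ _ hmem
  change K' = ⊤
  rw [eq_top_iff]
  rintro φ -
  rw [← h.smul_ext φ]
  exact Submodule.sum_mem _ fun y _ ↦ step (k + 1) y (by omega) φ

/-- Each syzygy raises `k` and lowers `d` by one; once `k ≥ n` no layers are left and the module is
zero. -/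
theorem pdLT_of_generatedFrom [IsSemiprimaryRing C] (h : IsColayered e lev η f) {n : ℕ}
    (hn : ∀ x, lev x < n) (d : ℕ) : ∀ (k : ℕ) (N : Type v) [AddCommGroup N] [Module C N],
      n ≤ k + d → DetectsCorner η f N → GeneratedFrom e lev k N → PdLT C N d := by
  induction d with
  | zero =>
    intro k N _ _ hk _ hN
    by_contra hcon
    have : Nontrivial N := by
      by_contra h0
      rw [not_nontrivial_iff_subsingleton] at h0
      exact hcon (pdLT_of_subsingleton 0)
    obtain ⟨y, -, hy, -⟩ := hN.exists_ne_zero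
    have := hn y
    omega
  | succ d ih =>
    intro k N _ _ hk hN hN'
    obtain ⟨ι, x, v, hx, hv, hspan, hmin⟩ := hN'.exists_minimal_generators h.idem
    obtain ⟨P, _, _, j, hP, hj, hj'⟩ := exists_projective_cornerSum h.idem x
    let π : P →ₗ[C] N := Finsupp.linearCombination C v ∘ₗ j
    have hπ : Function.Surjective π := by
      rw [← LinearMap.range_eq_top, eq_top_iff, ← hspan, Submodule.span_le]
      rintro _ ⟨i, rfl⟩
      obtain ⟨p, hp⟩ := (hj' (Finsupp.single i (e (x i)))).2 fun l ↦ by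
        by_cases hil : i = l
        · subst hil
          simpa using (h.idem (x i)).eq
        · simp [hil]
      exact ⟨p, by simp [π, hp, hv]⟩
    refine PdLT.of_ker hπ ?_ ((pdLT_one_iff.2 inferInstance).mono (by omega))
    refine ih (k + 1) _ (by omega) ?_
      (h.generatedFrom_ker hN hx j hj hj' π fun φ hφ ↦ hmin (j φ) hφ)
    exact ((h.detectsCorner_finsupp ι).of_injective j hj).of_injective (Submodule.subtype _)
      (Submodule.subtype_injective _)

/-- An arbitrary module need not detect corners, but its first syzygy in a free module does; this
step costs the one dimension between `< n` and `≤ n`. -/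
theorem leftGlobalDim_le [IsSemiprimaryRing C] (h : IsColayered e lev η f) {n : ℕ}
    (hn : ∀ x, lev x < n) : leftGlobalDim C ≤ n := by
  refine iSup_le fun N ↦ (CategoryTheory.projectiveDimension_le_iff N n).2 ?_
  let p : (N →₀ C) →ₗ[C] N := Finsupp.linearCombination C id
  have hp : Function.Surjective p := fun s ↦ ⟨Finsupp.single s 1, by simp [p]⟩
  refine PdLT.of_ker hp ?_ ((pdLT_one_iff.2 inferInstance).mono (by omega))
  refine h.pdLT_of_generatedFrom hn n 0 _ (by omega) ?_ ?_
  · exact (h.detectsCorner_finsupp N).of_injective _ (Submodule.subtype_injective _)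
  · rw [GeneratedFrom, eq_top_iff]
    rintro φ -
    rw [← h.smul_ext φ]
    exact Submodule.sum_mem _ fun y _ ↦
      Submodule.subset_span ⟨y, Nat.zero_le _, by rw [smul_smul, h.idem y]⟩

end IsColayered

end Colayered

/-! ### Radical series and Loewy length. -/

section RadicalSeries

variable {A : Type u} [Ring A] {X Y Z : Type v} [AddCommGroup X] [Module A X] [AddCommGroup Y]
  [Module A Y] [AddCommGroup Z] [Module A Z]

theorem radPow_succ (k : ℕ) : radPow A X (k + 1) = Ring.jacobson A • radPow A X k := rfl

theorem radPow_zero : radPow A X 0 = ⊤ := rfl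

theorem radPow_antitone : Antitone (radPow A X) :=
  antitone_nat_of_succ_le fun _ ↦ Submodule.smul_le_right

theorem map_radPow_le_add (f : X →ₗ[A] Y) {j : ℕ} (hf : LinearMap.range f ≤ radPow A Y j) (k : ℕ) :
    (radPow A X k).map f ≤ radPow A Y (j + k) := by
  induction k with
  | zero => rwa [radPow_zero, Submodule.map_top]
  | succ k ih =>
    rw [radPow_succ, Submodule.map_smul'', ← add_assoc, radPow_succ]
    exact Submodule.smul_mono le_rfl ih

theorem map_radPow_le (f : X →ₗ[A] Y) (k : ℕ) : (radPow A X k).map f ≤ radPow A Y k := by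
  simpa using map_radPow_le_add f (j := 0) le_top k

theorem map_radPow_of_surjective {f : X →ₗ[A] Y} (hf : Function.Surjective f) (k : ℕ) :
    (radPow A X k).map f = radPow A Y k := by
  induction k with
  | zero => rw [radPow_zero, Submodule.map_top, LinearMap.range_eq_top.2 hf, radPow_zero]
  | succ k ih => rw [radPow_succ, Submodule.map_smul'', ih, radPow_succ]

theorem radPow_eq_bot_of_surjective {f : X →ₗ[A] Y} (hf : Function.Surjective f) {k : ℕ}
    (h : radPow A X k = ⊥) : radPow A Y k = ⊥ := by
  rw [← map_radPow_of_surjective hf, h, Submodule.map_bot]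

theorem radPow_quotient_radPow (k : ℕ) : radPow A (X ⧸ radPow A X k) k = ⊥ := by
  rw [← map_radPow_of_surjective (Submodule.mkQ_surjective _), Submodule.mkQ_map_self]

/-- The functor `X ↦ X / J(A)^k X`. -/
def radQuot (f : X →ₗ[A] Y) (k : ℕ) : (X ⧸ radPow A X k) →ₗ[A] (Y ⧸ radPow A Y k) :=
  Submodule.mapQ _ _ f (Submodule.map_le_iff_le_comap.1 (map_radPow_le f k))

theorem radQuot_comp (g : Y →ₗ[A] Z) (f : X →ₗ[A] Y) (k : ℕ) :
    radQuot (g ∘ₗ f) k = radQuot g k ∘ₗ radQuot f k :=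
  Submodule.linearMap_qext _ (by ext; rfl)

theorem radQuot_id (k : ℕ) : radQuot (LinearMap.id : X →ₗ[A] X) k = LinearMap.id :=
  Submodule.linearMap_qext _ (by ext; rfl)

theorem radQuot_sum {ι : Type*} (s : Finset ι) (f : ι → X →ₗ[A] Y) (k : ℕ) :
    radQuot (∑ i ∈ s, f i) k = ∑ i ∈ s, radQuot (f i) k :=
  Submodule.linearMap_qext _ (by
    ext x
    simp only [radQuot, LinearMap.comp_apply, LinearMap.sum_apply, Submodule.mkQ_apply,
      Submodule.mapQ_apply]
    exact map_sum (Submodule.mkQ (radPow A Y k)) _ _)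

theorem exists_radPow_eq_bot [IsSemiprimaryRing A] : ∃ k, radPow A X k = ⊥ := by
  obtain ⟨n, hn⟩ := IsSemiprimaryRing.isNilpotent (R := A)
  have key (k : ℕ) : radPow A X k = (Ring.jacobson A) ^ k • (⊤ : Submodule A X) := by
    induction k with
    | zero => rw [Submodule.pow_zero, Ideal.one_eq_top, Submodule.top_smul, radPow_zero]
    | succ k ih => rw [radPow_succ, ih, ← Submodule.mul_smul, ← Ideal.IsTwoSided.pow_succ]
  exact ⟨n, by rw [key, hn, Submodule.zero_eq_bot, Submodule.bot_smul]⟩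

/-- Nilpotency of the radical makes the infimum in `loewyLength` attained, rather than the default
value of an empty `sInf`. -/
theorem radPow_eq_bot_iff [IsSemiprimaryRing A] {k : ℕ} :
    radPow A X k = ⊥ ↔ loewyLength A X ≤ k := by
  refine ⟨fun h ↦ Nat.sInf_le h, fun h ↦ ?_⟩
  have := Nat.sInf_mem (s := {k : ℕ | radPow A X k = ⊥}) exists_radPow_eq_bot
  exact eq_bot_iff.2 ((radPow_antitone h).trans (le_of_eq this))

theorem loewyLength_pos [IsSemiprimaryRing A] [Nontrivial X] : 0 < loewyLength A X := by
  rw [Nat.pos_iff_ne_zero]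
  intro h
  exact top_ne_bot (radPow_eq_bot_iff.2 h.le : radPow A X 0 = ⊥)

end RadicalSeries

/-! ### Local modules. -/

section Local

variable {A : Type u} [Ring A] [IsSemiprimaryRing A] {X Y : Type v} [AddCommGroup X] [Module A X]
  [AddCommGroup Y] [Module A Y]

theorem eq_top_of_sup_radPow_one_eq_top {S : Submodule A X} (h : S ⊔ radPow A X 1 = ⊤) : S = ⊤ :=
  eq_top_of_sup_jacobson_smul_eq_top S h

theorem IsLocalModule.le_radPow_one (hX : IsLocalModule A X) {S : Submodule A X} (hS : S ≠ ⊤) :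
    S ≤ radPow A X 1 := by
  by_contra h
  refine hS (eq_top_of_sup_radPow_one_eq_top ?_)
  exact (isSimpleModule_iff_isCoatom.1 hX).2 _ (right_lt_sup.2 h)

omit [IsSemiprimaryRing A] in
theorem IsLocalModule.nontrivial (hX : IsLocalModule A X) : Nontrivial X := by
  have : IsSimpleModule A (X ⧸ radPow A X 1) := hX
  have := IsSimpleModule.nontrivial A (X ⧸ radPow A X 1)
  exact (Submodule.mkQ_surjective (radPow A X 1)).nontrivial

theorem IsLocalModule.isIndecomposable (hX : IsLocalModule A X) : IsIndecomposable A X := by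
  refine ⟨hX.nontrivial, fun U V hUV ↦ ?_⟩
  by_contra! h
  have hU : U ≠ ⊤ := fun h0 ↦ h.2 (by simpa [h0] using hUV.disjoint)
  have hV : V ≠ ⊤ := fun h0 ↦ h.1 (by simpa [h0] using hUV.disjoint)
  refine (isSimpleModule_iff_isCoatom.1 hX).1 (eq_top_iff.2 ?_)
  rw [← hUV.sup_eq_top]
  exact sup_le (hX.le_radPow_one hU) (hX.le_radPow_one hV)

/-- The simple top of `X` maps onto the top of `Y`, which is nonzero by Nakayama. -/
theorem IsLocalModule.of_surjective [Nontrivial Y] (hX : IsLocalModule A X) {f : X →ₗ[A] Y}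
    (hf : Function.Surjective f) : IsLocalModule A Y := by
  have hs : Function.Surjective (radQuot f 1) := by
    intro y
    obtain ⟨y, rfl⟩ := Submodule.mkQ_surjective _ y
    obtain ⟨x, rfl⟩ := hf y
    exact ⟨Submodule.mkQ _ x, rfl⟩
  have : IsSimpleModule A (X ⧸ radPow A X 1) := hX
  have hne : radPow A Y 1 ≠ ⊤ := fun h ↦ by
    have := eq_top_of_sup_radPow_one_eq_top (A := A) (X := Y) (S := ⊥) (by rw [h, sup_top_eq])
    exact bot_ne_top this
  have : Nontrivial (Y ⧸ radPow A Y 1) := Submodule.Quotient.nontrivial_iff.2 hne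
  obtain hi | h0 := (radQuot f 1).injective_or_eq_zero
  · exact IsSimpleModule.congr (LinearEquiv.ofBijective _ ⟨hi, hs⟩).symm
  · obtain ⟨y, hy⟩ := exists_ne (0 : Y ⧸ radPow A Y 1)
    obtain ⟨x, rfl⟩ := hs y
    exact absurd (by rw [h0]; rfl) hy

end Local

/-! ### Fitting's lemma and Krull-Schmidt. -/

section Indecomposable

variable {A : Type u} [Ring A] {X Y N : Type v} [AddCommGroup X] [Module A X]
  [AddCommGroup Y] [Module A Y] [AddCommGroup N] [Module A N]

theorem isCompl_range_ker_of_comp_eq_id {a : X →ₗ[A] Y} {b : Y →ₗ[A] X}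
    (h : b ∘ₗ a = LinearMap.id) : IsCompl (LinearMap.range a) (LinearMap.ker b) := by
  have h' (x) : b (a x) = x := LinearMap.congr_fun h x
  constructor
  · rw [Submodule.disjoint_def]
    rintro _ ⟨x, rfl⟩ hx
    rw [← h' x, LinearMap.mem_ker.1 hx, map_zero]
  · rw [codisjoint_iff, eq_top_iff]
    rintro y -
    rw [← add_sub_cancel (a (b y)) y]
    exact Submodule.add_mem_sup ⟨b y, rfl⟩ (by simp [h'])

theorem IsIndecomposable.of_equiv (hX : IsIndecomposable A X) (ε : X ≃ₗ[A] Y) :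
    IsIndecomposable A Y := by
  refine ⟨have := hX.1; ε.symm.surjective.nontrivial, fun U V h ↦ ?_⟩
  simpa [map_eq_bot_iff] using hX.2 _ _ ((Submodule.orderIsoMapComap ε.symm).isCompl h)

/-- Fitting: for large `n` the kernel and range of `g ^ n` are complementary, so one of them is
zero. -/
theorem isUnit_or_isNilpotent [IsNoetherian A X] [IsArtinian A X] (hX : IsIndecomposable A X)
    (g : Module.End A X) : IsUnit g ∨ IsNilpotent g := by
  obtain ⟨n, hn, hn1⟩ := (g.eventually_isCompl_ker_pow_range_pow.and
    (Filter.eventually_ge_atTop 1)).exists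
  obtain h | h := hX.2 _ _ hn
  · left
    have hi : Function.Injective g := by
      have := LinearMap.ker_eq_bot.1 h
      obtain ⟨m, rfl⟩ : ∃ m, n = m + 1 := ⟨n - 1, by omega⟩
      rw [pow_succ, Module.End.mul_eq_comp, LinearMap.coe_comp] at this
      exact this.of_comp
    exact (Module.End.isUnit_iff g).2 (IsArtinian.bijective_of_injective_endomorphism g hi)
  · exact Or.inr ⟨n, LinearMap.range_eq_bot.1 h⟩

theorem isUnit_or_isUnit_of_add [IsNoetherian A X] [IsArtinian A X] (hX : IsIndecomposable A X)
    {g g' : Module.End A X} (h : IsUnit (g + g')) : IsUnit g ∨ IsUnit g' := by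
  obtain ⟨w, hw⟩ := h
  have hsum : (w⁻¹ : (Module.End A X)ˣ) * g + (w⁻¹ : (Module.End A X)ˣ) * g' = 1 := by
    rw [← mul_add, ← hw, Units.inv_mul]
  obtain h1 | h1 := isUnit_or_isNilpotent hX ((w⁻¹ : (Module.End A X)ˣ) * g)
  · exact Or.inl ((Units.isUnit_units_mul _ _).1 h1)
  · right
    have h2 := h1.isUnit_one_sub
    rw [← hsum, add_sub_cancel_left] at h2
    exact (Units.isUnit_units_mul _ _).1 h2

theorem exists_isUnit_of_sum [IsNoetherian A X] [IsArtinian A X] (hX : IsIndecomposable A X)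
    {ι : Type*} (s : Finset ι) (g : ι → Module.End A X) (h : IsUnit (∑ i ∈ s, g i)) :
    ∃ i, IsUnit (g i) := by
  classical
  induction s using Finset.induction_on with
  | empty =>
    have := hX.1
    simp at h
  | insert i s hi ih =>
    rw [Finset.sum_insert hi] at h
    obtain h | h := isUnit_or_isUnit_of_add hX h
    · exact ⟨i, h⟩
    · exact ih h

/-- `b` is a split monomorphism, so its image is a nonzero direct summand of the indecomposable `Y`.
-/
theorem nonempty_equiv_of_isUnit_comp [Nontrivial X] (hY : IsIndecomposable A Y) {a : Y →ₗ[A] X}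
    {b : X →ₗ[A] Y} (h : IsUnit (a ∘ₗ b : Module.End A X)) : Nonempty (X ≃ₗ[A] Y) := by
  obtain ⟨w, hw⟩ := h
  have hid : ((w⁻¹ : (Module.End A X)ˣ).1 ∘ₗ a) ∘ₗ b = LinearMap.id := by
    rw [LinearMap.comp_assoc, ← hw]
    exact Units.inv_mul w
  have hinj : Function.Injective b :=
    Function.LeftInverse.injective (g := (w⁻¹ : (Module.End A X)ˣ).1 ∘ₗ a) (LinearMap.congr_fun hid)
  have hc := isCompl_range_ker_of_comp_eq_id hid
  obtain h | h := hY.2 _ _ hc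
  · exfalso
    obtain ⟨x, hx⟩ := exists_ne (0 : X)
    rw [LinearMap.range_eq_bot] at h
    exact hx (hinj (by rw [h]; simp))
  · rw [h] at hc
    exact ⟨LinearEquiv.ofBijective b ⟨hinj, LinearMap.range_eq_top.1 (by simpa using hc.sup_eq_top)⟩⟩

/-- An indecomposable module of finite length which is a direct summand of a finite direct sum of
indecomposable modules is isomorphic to one of them. -/
theorem exists_equiv_of_sum_eq_id [IsNoetherian A X] [IsArtinian A X] (hX : IsIndecomposable A X)
    {ι : Type*} [Fintype ι] {Z : ι → Type v} [∀ i, AddCommGroup (Z i)] [∀ i, Module A (Z i)]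
    (hZ : ∀ i, IsIndecomposable A (Z i)) (a : ∀ i, Z i →ₗ[A] X) (b : ∀ i, X →ₗ[A] Z i)
    (h : ∑ i, a i ∘ₗ b i = LinearMap.id) : ∃ i, Nonempty (X ≃ₗ[A] Z i) := by
  obtain ⟨i, hi⟩ := exists_isUnit_of_sum hX Finset.univ (fun i ↦ a i ∘ₗ b i)
    (h ▸ isUnit_one)
  have := hX.1
  exact ⟨i, nonempty_equiv_of_isUnit_comp (hZ i) hi⟩

theorem IndecClass.isIndecomposable_rep (c : IndecClass A N) : IsIndecomposable A c.rep :=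
  (Quotient.out (s := indecSetoid A N) c).2.2

theorem IndecClass.exists_projection (c : IndecClass A N) :
    ∃ p : N →ₗ[A] c.rep, p ∘ₗ c.rep.subtype = LinearMap.id := by
  obtain ⟨T, hT⟩ := (Quotient.out (s := indecSetoid A N) c).2.1
  exact ⟨Submodule.projectionOnto _ T hT, Submodule.projectionOnto_comp_subtype hT⟩

theorem IndecClass.eq_of_equiv {c d : IndecClass A N} (ε : c.rep ≃ₗ[A] d.rep) : c = d := by
  rw [← Quotient.out_eq (s := indecSetoid A N) c, ← Quotient.out_eq (s := indecSetoid A N) d]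
  exact Quotient.sound (s := indecSetoid A N) ⟨ε⟩

theorem IndecClass.exists_rep_equiv (hX : IsIndecomposable A X) {a : X →ₗ[A] N} {b : N →ₗ[A] X}
    (h : b ∘ₗ a = LinearMap.id) : ∃ c : IndecClass A N, Nonempty (c.rep ≃ₗ[A] X) := by
  have hinj : Function.Injective a :=
    Function.LeftInverse.injective (g := b) (LinearMap.congr_fun h)
  let ε := LinearEquiv.ofInjective a hinj
  let S : IndecSummand A N :=
    ⟨LinearMap.range a, ⟨_, isCompl_range_ker_of_comp_eq_id h⟩, hX.of_equiv ε⟩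
  obtain ⟨ε'⟩ : Nonempty ((Quotient.out (s := indecSetoid A N) (Quotient.mk _ S)).1 ≃ₗ[A] S.1) :=
    Quotient.exact (s := indecSetoid A N) (Quotient.out_eq _)
  exact ⟨Quotient.mk (indecSetoid A N) S, ⟨ε'.trans ε.symm⟩⟩

end Indecomposable

section

variable {A : Type u} [Ring A] {L X Y : Type v} [AddCommGroup L] [Module A L] [AddCommGroup X]
  [Module A X] [AddCommGroup Y] [Module A Y]

theorem exists_surjective_ker_eq_radPow {g : L →ₗ[A] X} (hg : Function.Surjective g) {j : ℕ}
    (hker : LinearMap.ker g ≤ radPow A L j) (ε : Y ≃ₗ[A] (L ⧸ radPow A L j)) :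
    ∃ f : X →ₗ[A] Y, Function.Surjective f ∧ LinearMap.ker f = radPow A X j := by
  let q := Submodule.mkQ (radPow A X j) ∘ₗ g
  have hq : Function.Surjective q := (Submodule.mkQ_surjective _).comp hg
  have h : LinearMap.ker q = radPow A L j := by
    rw [LinearMap.ker_comp, Submodule.ker_mkQ, ← map_radPow_of_surjective hg,
      Submodule.comap_map_eq, sup_eq_left.2 hker]
  let ε' : (X ⧸ radPow A X j) ≃ₗ[A] Y :=
    ((Submodule.quotEquivOfEq _ _ h.symm).trans (q.quotKerEquivOfSurjective hq)).symm.trans ε.symm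
  refine ⟨ε'.toLinearMap ∘ₗ Submodule.mkQ _, ε'.surjective.comp (Submodule.mkQ_surjective _), ?_⟩
  rw [LinearMap.ker_comp, LinearEquiv.ker, Submodule.comap_bot, Submodule.ker_mkQ]

theorem IndecClass.exists_surjective_ker_eq_radPow {N : Type v} [AddCommGroup N] [Module A N]
    (c d : IndecClass A N) {i j : ℕ} (hij : j ≤ i) (ε : c.rep ≃ₗ[A] (L ⧸ radPow A L i))
    (ε' : d.rep ≃ₗ[A] (L ⧸ radPow A L j)) :
    ∃ f : c.rep →ₗ[A] d.rep, Function.Surjective f ∧ LinearMap.ker f = radPow A c.rep j := by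
  refine ADR.exists_surjective_ker_eq_radPow (g := ε.symm.toLinearMap ∘ₗ Submodule.mkQ _)
    (ε.symm.surjective.comp (Submodule.mkQ_surjective _)) ?_ ε'
  rw [LinearMap.ker_comp, LinearEquiv.ker, Submodule.comap_bot, Submodule.ker_mkQ]
  exact radPow_antitone hij

end

/-! ### The indecomposable summands of the radical quotients of a semilocal module. -/

section Semilocal

variable {A : Type u} [Ring A] {M : Type v} [AddCommGroup M] [Module A M]

theorem IsSemilocalModule.exists_decomposition [IsNoetherian A M] (hM : IsSemilocalModule A M) :
    ∃ (ι : Type v) (_ : Fintype ι) (L : ι → Submodule A M) (p : ∀ k, M →ₗ[A] L k),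
      (∀ k, IsLocalModule A (L k)) ∧ (∀ k, p k ∘ₗ (L k).subtype = LinearMap.id) ∧
      ∑ k, (L k).subtype ∘ₗ p k = LinearMap.id := by
  obtain ⟨ι, _, L, hL, hloc⟩ := hM
  have hfin : Finite ι := WellFoundedGT.finite_of_iSupIndep hL.submodule_iSupIndep fun k ↦
    (Submodule.nontrivial_iff_ne_bot).1 (hloc k).nontrivial
  have := Fintype.ofFinite ι
  let ε := LinearEquiv.ofBijective (DirectSum.coeLinearMap L) hL
  have hε (k) (y : L k) : ε.symm y = DirectSum.lof A ι (fun k ↦ L k) k y := by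
    rw [LinearEquiv.symm_apply_eq]
    exact (DirectSum.coeLinearMap_lof (A := L) k y).symm
  refine ⟨ι, this, L, fun k ↦ DirectSum.component A ι (fun k ↦ L k) k ∘ₗ ε.symm.toLinearMap,
    hloc, fun k ↦ ?_, ?_⟩
  · ext y : 1
    simp only [LinearMap.comp_apply, Submodule.subtype_apply, LinearEquiv.coe_coe, hε,
      DirectSum.component.lof_self, LinearMap.id_apply]
  · ext y
    obtain ⟨z, rfl⟩ := ε.surjective y
    induction z using DirectSum.induction_on with
    | zero => simp
    | of k z =>
      rw [← DirectSum.lof_eq_of A, LinearMap.sum_apply, Finset.sum_eq_single k]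
      · simp only [LinearMap.comp_apply, LinearEquiv.coe_coe, LinearEquiv.symm_apply_apply,
          DirectSum.component.lof_self, Submodule.subtype_apply, LinearMap.id_apply]
        exact (DirectSum.coeLinearMap_lof (A := L) k z).symm
      · intro l _ hl
        simp only [LinearMap.comp_apply, LinearEquiv.coe_coe, LinearEquiv.symm_apply_apply,
          DirectSum.component.of, dif_neg hl.symm, map_zero]
      · simp
    | add y z hy hz => rw [map_add, map_add, hy, hz, map_add]

variable [IsArtinianRing A] [Module.Finite A M]

/-- The indecomposable summands of `M̃` are the radical quotients of the local summands of `M`. -/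
theorem IsSemilocalModule.exists_local_family (hM : IsSemilocalModule A M) :
    ∃ (ι : Type v) (_ : Fintype ι) (L : ι → Submodule A M),
      (∀ k, IsLocalModule A (L k)) ∧
      (∀ c : Summands A M, ∃ k, ∃ i : Fin (loewyLength A M),
        Nonempty (c.rep ≃ₗ[A] (L k ⧸ radPow A (L k) (i + 1)))) ∧
      ∀ k, ∀ i : Fin (loewyLength A M), ∃ c : Summands A M,
        Nonempty (c.rep ≃ₗ[A] (L k ⧸ radPow A (L k) (i + 1))) := by
  classical
  obtain ⟨ι, _, L, p, hL, hp, hsum⟩ := hM.exists_decomposition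
  have hZ (k : ι) (i : ℕ) : IsIndecomposable A (L k ⧸ radPow A (L k) (i + 1)) := by
    have hk := hL k
    have := hk.nontrivial
    have hne : radPow A (L k) (i + 1) ≠ ⊤ := fun h ↦
      (isSimpleModule_iff_isCoatom.1 hk).1 (top_le_iff.1 (h ▸ radPow_antitone (by omega)))
    have := Submodule.Quotient.nontrivial_iff.2 hne
    exact (hk.of_surjective (Submodule.mkQ_surjective _)).isIndecomposable
  let a (k : ι) (i : Fin (loewyLength A M)) :
      (L k ⧸ radPow A (L k) (i + 1)) →ₗ[A] RadQuotientSum A M :=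
    DirectSum.lof A _ (fun i : Fin (loewyLength A M) ↦ M ⧸ radPow A M (i + 1)) i ∘ₗ
      radQuot (L k).subtype (i + 1)
  let b (k : ι) (i : Fin (loewyLength A M)) :
      RadQuotientSum A M →ₗ[A] (L k ⧸ radPow A (L k) (i + 1)) :=
    radQuot (p k) (i + 1) ∘ₗ
      DirectSum.component A _ (fun i : Fin (loewyLength A M) ↦ M ⧸ radPow A M (i + 1)) i
  have hba (k i) : b k i ∘ₗ a k i = LinearMap.id := by
    rw [← radQuot_id, ← hp k, radQuot_comp]
    refine LinearMap.ext fun x ↦ ?_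
    simp only [a, b, LinearMap.comp_apply, DirectSum.component.lof_self]
  have hab : ∑ x : ι × Fin (loewyLength A M), a x.1 x.2 ∘ₗ b x.1 x.2 = LinearMap.id := by
    rw [Fintype.sum_prod_type_right]
    have h1 (i : Fin (loewyLength A M)) : ∑ k, a k i ∘ₗ b k i =
        DirectSum.lof A _ (fun i : Fin (loewyLength A M) ↦ M ⧸ radPow A M (i + 1)) i ∘ₗ
        DirectSum.component A _ (fun i : Fin (loewyLength A M) ↦ M ⧸ radPow A M (i + 1)) i := by
      have := congr_arg (fun g ↦ radQuot g ((i : ℕ) + 1)) hsum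
      simp only [radQuot_sum, radQuot_comp, radQuot_id] at this
      refine LinearMap.ext fun x ↦ ?_
      have h2 := LinearMap.congr_fun this (DirectSum.component A _
        (fun i : Fin (loewyLength A M) ↦ M ⧸ radPow A M (i + 1)) i x)
      simp only [LinearMap.sum_apply, LinearMap.comp_apply, LinearMap.id_apply] at h2
      simp only [a, b, LinearMap.sum_apply, LinearMap.comp_apply, ← map_sum, h2]
    simp only [h1]
    refine LinearMap.ext fun x ↦ ?_
    simp only [LinearMap.sum_apply, LinearMap.comp_apply, LinearMap.id_apply]
    refine DirectSum.ext_component A fun j ↦ ?_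
    rw [map_sum, Finset.sum_eq_single j]
    · rw [DirectSum.component.lof_self]
    · intro i _ hij
      rw [DirectSum.component.of, dif_neg hij]
    · simp
  refine ⟨ι, inferInstance, L, hL, fun c ↦ ?_, fun k i ↦
    IndecClass.exists_rep_equiv (hZ k i) (hba k i)⟩
  -- Cutting `hab` down to the summand `c.rep` writes its identity as a sum of maps through the
  -- local quotients.
  obtain ⟨q, hq⟩ := c.exists_projection
  obtain ⟨x, hx⟩ := exists_equiv_of_sum_eq_id c.isIndecomposable_rep
    (Z := fun x : ι × Fin (loewyLength A M) ↦ L x.1 ⧸ radPow A (L x.1) (x.2 + 1))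
    (fun x ↦ hZ x.1 x.2) (fun x ↦ q ∘ₗ a x.1 x.2) (fun x ↦ b x.1 x.2 ∘ₗ c.rep.subtype) (by
      rw [← hq]
      ext y : 1
      have := LinearMap.congr_fun hab y
      simp only [LinearMap.sum_apply, LinearMap.comp_apply, LinearMap.id_apply] at this
      simp only [LinearMap.sum_apply, LinearMap.comp_apply, ← map_sum]
      exact congr_arg q this)
  exact ⟨x.1, x.2, hx⟩

theorem IsSemilocalModule.finite_summands (hM : IsSemilocalModule A M) :
    Finite (Summands A M) := by
  obtain ⟨ι, _, L, -, h, -⟩ := hM.exists_local_family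
  choose k i ε using h
  refine Finite.of_injective (fun c ↦ (k c, i c)) fun c d hcd ↦ ?_
  simp only [Prod.mk.injEq] at hcd
  obtain ⟨ε₁⟩ := ε c
  obtain ⟨ε₂⟩ := ε d
  rw [← hcd.1, ← hcd.2] at ε₂
  exact IndecClass.eq_of_equiv (ε₁.trans ε₂.symm)

theorem IsSemilocalModule.isLocalModule_rep (hM : IsSemilocalModule A M) (c : Summands A M) :
    IsLocalModule A c.rep := by
  obtain ⟨ι, _, L, hL, h, -⟩ := hM.exists_local_family
  obtain ⟨k, i, ⟨ε⟩⟩ := h c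
  have := c.isIndecomposable_rep.1
  exact (hL k).of_surjective (f := ε.symm.toLinearMap ∘ₗ Submodule.mkQ _)
    (ε.symm.surjective.comp (Submodule.mkQ_surjective _))

theorem IsSemilocalModule.loewyLength_rep_le (hM : IsSemilocalModule A M) (c : Summands A M) :
    loewyLength A c.rep ≤ loewyLength A M := by
  obtain ⟨ι, _, L, hL, h, -⟩ := hM.exists_local_family
  obtain ⟨k, i, ⟨ε⟩⟩ := h c
  refine radPow_eq_bot_iff.1 (radPow_eq_bot_of_surjective (f := ε.symm.toLinearMap)
    ε.symm.surjective (eq_bot_iff.2 ?_))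
  exact (radPow_antitone i.2).trans (radPow_quotient_radPow _).le

/-- The quotients of the summands of `M̃` by terms of the radical series are summands of `M̃`. -/
theorem IsSemilocalModule.exists_quotient_summand (hM : IsSemilocalModule A M)
    (c : Summands A M) {j : ℕ} (hj : j + 1 ≤ loewyLength A c.rep) :
    ∃ d : Summands A M, ∃ f : c.rep →ₗ[A] d.rep, Function.Surjective f ∧
      LinearMap.ker f = radPow A c.rep (j + 1) := by
  have hm := hM.loewyLength_rep_le c
  obtain ⟨ι, _, L, hL, h, h'⟩ := hM.exists_local_family
  obtain ⟨k, i, ⟨ε⟩⟩ := h c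
  -- Only `≤ i + 1` holds for the Loewy length of `c.rep`, as `L k` may be shorter; this suffices.
  have hji : j ≤ i := by
    have : loewyLength A c.rep ≤ i + 1 := radPow_eq_bot_iff.1
      (radPow_eq_bot_of_surjective (f := ε.symm.toLinearMap) ε.symm.surjective
        (radPow_quotient_radPow _))
    omega
  obtain ⟨d, ⟨ε'⟩⟩ := h' k ⟨j, by omega⟩
  exact ⟨d, c.exists_surjective_ker_eq_radPow d (by omega) ε ε'⟩

end Semilocal

/-! ### Radical maps and maps into local modules. -/

section Radical

variable {A : Type u} [Ring A] {X Y : Type v} [AddCommGroup X] [Module A X] [AddCommGroup Y]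
  [Module A Y]

theorem IsRadicalMap.not_injective [Nontrivial X] {f : X →ₗ[A] Y} (hf : IsRadicalMap f)
    (hs : Function.Surjective f) : ¬ Function.Injective f := fun hi ↦ by
  have := hf (LinearEquiv.ofBijective f ⟨hi, hs⟩).symm.toLinearMap
  have h0 : (LinearEquiv.ofBijective f ⟨hi, hs⟩).symm.toLinearMap ∘ₗ f = 1 := by
    ext x
    exact (LinearEquiv.ofBijective f ⟨hi, hs⟩).symm_apply_apply x
  rw [h0, sub_self] at this
  exact not_isUnit_zero this

theorem IsRadicalMap.length_lt [IsNoetherian A X] [IsArtinian A X] [Nontrivial X] {f : X →ₗ[A] Y}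
    (hf : IsRadicalMap f) (hs : Function.Surjective f) :
    Module.length A Y < Module.length A X := by
  rw [← (f.quotKerEquivOfSurjective hs).length_eq]
  exact Submodule.length_quotient_lt _ fun h ↦
    hf.not_injective hs (LinearMap.ker_eq_bot.1 h)

/-- If `1 - g f` is not invertible then `g f` is, because the endomorphism ring of `X` is local; so
`f` is injective. -/
theorem bijective_or_isRadicalMap_of_surjective [IsNoetherian A X] [IsArtinian A X]
    (hX : IsIndecomposable A X) {f : X →ₗ[A] Y} (hs : Function.Surjective f) :
    Function.Bijective f ∨ IsRadicalMap f := by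
  by_contra! h
  obtain ⟨g, hg⟩ := not_forall.1 h.2
  obtain h1 | h1 := isUnit_or_isUnit_of_add hX (g := 1 - g ∘ₗ f) (g' := g ∘ₗ f)
    (by rw [sub_add_cancel]; exact isUnit_one)
  · exact hg h1
  · have := ((Module.End.isUnit_iff _).1 h1).1
    rw [LinearMap.coe_comp] at this
    exact h.1 ⟨this.of_comp, hs⟩

/-- A map from `X` to a local module of at most the same Loewy length which is not surjective
kills the last nonzero term of the radical series of `X`. -/
theorem IsLocalModule.le_ker_of_not_surjective [IsSemiprimaryRing A] (hY : IsLocalModule A Y)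
    {f : X →ₗ[A] Y} (hf : ¬ Function.Surjective f) {k : ℕ} (hk : loewyLength A Y ≤ k + 1) :
    radPow A X k ≤ LinearMap.ker f := by
  rw [LinearMap.le_ker_iff_map, eq_bot_iff, ← radPow_eq_bot_iff.2 hk, add_comm k 1]
  exact map_radPow_le_add f (hY.le_radPow_one (mt LinearMap.range_eq_top.1 hf)) k

theorem le_ker_of_loewyLength_le [IsSemiprimaryRing A] (f : X →ₗ[A] Y) {k : ℕ}
    (hk : loewyLength A Y ≤ k) : radPow A X k ≤ LinearMap.ker f := by
  rw [LinearMap.le_ker_iff_map, eq_bot_iff, ← radPow_eq_bot_iff.2 hk]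
  exact map_radPow_le f k

end Radical

/-! ### The layers exhaust each level and are totally ordered. -/

section Layers

variable {A : Type u} [Ring A] {N : Type v} [AddCommGroup N] [Module A N]

theorem mem_bottomLayer_of_length [IsNoetherian A N] [IsArtinian A N] {S : Set (IndecClass A N)}
    {c : IndecClass A N} (hc : c ∈ S)
    (h : ∀ d ∈ S, Module.length A c.rep ≤ Module.length A d.rep) : c ∈ bottomLayer S := by
  refine ⟨hc, fun d hd ⟨f, hf, hs⟩ ↦ ?_⟩
  have := c.isIndecomposable_rep.1
  exact (h d hd).not_gt (hf.length_lt hs)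

/-- A member of minimal length works, since surjective radical maps strictly lower the length. -/
theorem bottomLayer_nonempty [IsNoetherian A N] [IsArtinian A N] {S : Set (IndecClass A N)}
    (hS : S.Nonempty) : (bottomLayer S).Nonempty := by
  obtain ⟨c, hc, h⟩ := WellFounded.has_min
    (InvImage.wf (fun c : IndecClass A N ↦ Module.length A c.rep) wellFounded_lt) S hS
  exact ⟨c, mem_bottomLayer_of_length hc fun d hd ↦ not_lt.1 (h d hd)⟩

end Layers

section LayerUnion

variable {A : Type u} [Ring A] {M : Type v} [AddCommGroup M] [Module A M]

theorem layerUnion_mono (i : ℕ) : Monotone (layerUnion A M i) :=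
  monotone_nat_of_le_succ fun _ ↦ Set.subset_union_left

theorem layerUnion_subset (i j : ℕ) : layerUnion A M i j ⊆ level A M i := by
  induction j with
  | zero => exact Set.empty_subset _
  | succ j ih => exact Set.union_subset ih fun c hc ↦ hc.1.1

/-- Until the level is exhausted, each step adds a nonempty bottom layer, and there are finitely
many classes. Hence the infimum `layerCount` is attained. -/
theorem exists_level_eq_layerUnion [Finite (Summands A M)]
    [IsNoetherian A (RadQuotientSum A M)] [IsArtinian A (RadQuotientSum A M)] (i : ℕ) :
    ∃ j, level A M i = layerUnion A M i j := by
  by_contra! h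
  have hlt (j : ℕ) : (layerUnion A M i j).ncard < (layerUnion A M i (j + 1)).ncard := by
    refine Set.ncard_lt_ncard (LE.le.ssubset_of_not_superset
      (layerUnion_mono i j.le_succ) fun hsub ↦ ?_) (Set.toFinite _)
    obtain ⟨c, hc⟩ := bottomLayer_nonempty (S := level A M i \ layerUnion A M i j)
      (Set.sdiff_nonempty.2 fun h' ↦ h j (h'.antisymm (layerUnion_subset i j)))
    exact hc.1.2 (hsub (Or.inr hc))
  have := (strictMono_nat_of_lt_succ hlt).le_apply (x := Nat.card (Summands A M) + 1)
  have h2 := Set.ncard_le_card (layerUnion A M i (Nat.card (Summands A M) + 1))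
  omega

/-- The position of the layer of `c` in the sequence of all the layers. -/
def layerIndex (c : Summands A M) : ℕ :=
  ∑ i ∈ Finset.range (loewyLength A M - loewyLength A c.rep), layerCount A M i +
    sInf {j | c ∈ layerUnion A M (loewyLength A M - loewyLength A c.rep) (j + 1)}

theorem mem_level {c : Summands A M} (hc : loewyLength A c.rep ≤ loewyLength A M) :
    c ∈ level A M (loewyLength A M - loewyLength A c.rep) := by
  change _ = _
  omega

theorem layer_spec [Finite (Summands A M)] [IsNoetherian A (RadQuotientSum A M)]
    [IsArtinian A (RadQuotientSum A M)] {c : Summands A M}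
    (hc : loewyLength A c.rep ≤ loewyLength A M) {i : ℕ}
    (hi : i = loewyLength A M - loewyLength A c.rep) {j : ℕ}
    (hj : j = sInf {j | c ∈ layerUnion A M i (j + 1)}) :
    j < layerCount A M i ∧ c ∉ layerUnion A M i j ∧
      c ∈ bottomLayer (level A M i \ layerUnion A M i j) := by
  have hn : level A M i = layerUnion A M i (layerCount A M i) :=
    Nat.sInf_mem (exists_level_eq_layerUnion i)
  have hcl : c ∈ level A M i := hi ▸ mem_level hc
  have hnot : c ∉ layerUnion A M i j := by
    intro h
    rcases j with _ | j
    · exact h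
    · have : sInf {j | c ∈ layerUnion A M i (j + 1)} ≤ j := Nat.sInf_le h
      omega
  have hjn : j < layerCount A M i := by
    by_contra! h
    exact hnot (layerUnion_mono i h (hn ▸ hcl))
  have hmem : c ∈ layerUnion A M i (j + 1) := by
    rw [hj]
    refine Nat.sInf_mem (s := {j | c ∈ layerUnion A M i (j + 1)}) ⟨layerCount A M i, ?_⟩
    exact layerUnion_mono i (Nat.le_succ _) (hn ▸ hcl)
  exact ⟨hjn, hnot, hmem.resolve_left hnot⟩

theorem layerIndex_lt_sum [Finite (Summands A M)] [IsNoetherian A (RadQuotientSum A M)]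
    [IsArtinian A (RadQuotientSum A M)] {c : Summands A M}
    (hc : loewyLength A c.rep ≤ loewyLength A M) {k : ℕ}
    (hk : loewyLength A M - loewyLength A c.rep < k) :
    layerIndex c < ∑ i ∈ Finset.range k, layerCount A M i := by
  have h1 := (layer_spec hc rfl rfl).1
  have h2 : ∑ i ∈ Finset.range (loewyLength A M - loewyLength A c.rep + 1), layerCount A M i ≤
      ∑ i ∈ Finset.range k, layerCount A M i :=
    Finset.sum_le_sum_of_subset (Finset.range_mono hk)
  rw [Finset.sum_range_succ] at h2
  unfold layerIndex
  omega

theorem layerIndex_lt_of_loewyLength_lt [Finite (Summands A M)]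
    [IsNoetherian A (RadQuotientSum A M)] [IsArtinian A (RadQuotientSum A M)] {c d : Summands A M}
    (hc : loewyLength A c.rep ≤ loewyLength A M)
    (h : loewyLength A d.rep < loewyLength A c.rep) : layerIndex c < layerIndex d :=
  (layerIndex_lt_sum hc (by omega)).trans_le (Nat.le_add_right _ _)

/-- `S` is what remains of the level just before the layer of `c` is removed; `d` is removed no
earlier. -/
theorem exists_bottomLayer_of_layerIndex_le [Finite (Summands A M)]
    [IsNoetherian A (RadQuotientSum A M)] [IsArtinian A (RadQuotientSum A M)] {c d : Summands A M}
    (hc : loewyLength A c.rep ≤ loewyLength A M) (hd : loewyLength A d.rep ≤ loewyLength A M)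
    (hcd : layerIndex c ≤ layerIndex d) (h : loewyLength A d.rep = loewyLength A c.rep) :
    ∃ S : Set (Summands A M), c ∈ bottomLayer S ∧ d ∈ S := by
  obtain ⟨-, -, hcb⟩ := layer_spec hc rfl rfl
  obtain ⟨-, hdn, hdb⟩ := layer_spec hd rfl rfl
  unfold layerIndex at hcd
  rw [h] at hcd hdn hdb
  refine ⟨_, hcb, hdb.1.1, fun hd' ↦ hdn (layerUnion_mono _ ?_ hd')⟩
  omega

end LayerUnion

/-! ### Reflections. -/

section Factor

variable {A : Type u} [Ring A] [IsSemiprimaryRing A] {N : Type v} [AddCommGroup N] [Module A N]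
  [IsNoetherian A N] [IsArtinian A N]

/-- The layers given by `lev` refine the order by decreasing Loewy length, and are compatible
with the bottom layers. -/
structure IsLayering (A : Type u) [Ring A] {N : Type v} [AddCommGroup N] [Module A N]
    (lev : IndecClass A N → ℕ) : Prop where
  isLocal : ∀ c : IndecClass A N, IsLocalModule A c.rep
  loewyLength_le : ∀ c d, lev c ≤ lev d → loewyLength A d.rep ≤ loewyLength A c.rep
  exists_bottomLayer : ∀ c d, lev c ≤ lev d → loewyLength A d.rep = loewyLength A c.rep →
    ∃ S : Set (IndecClass A N), c ∈ bottomLayer S ∧ d ∈ S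
  exists_quotient : ∀ (c : IndecClass A N) (j : ℕ), j + 1 ≤ loewyLength A c.rep →
    ∃ d : IndecClass A N, ∃ f : c.rep →ₗ[A] d.rep, Function.Surjective f ∧
      LinearMap.ker f = radPow A c.rep (j + 1)

variable {lev : IndecClass A N → ℕ}

/-- A non-surjective `f` lands in the radical of the local module `d.rep`, which shifts the radical
series by one. A surjection onto a shorter module kills the last radical power. A surjection at
equal Loewy length is bijective, since a radical one would contradict `c` being in the bottom layer.
-/
theorem IsLayering.bijective_or_le_ker (h : IsLayering A lev) {c d : IndecClass A N}
    (hcd : lev c ≤ lev d) (f : c.rep →ₗ[A] d.rep) {k : ℕ} (hk : loewyLength A c.rep = k + 1) :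
    Function.Bijective f ∨ radPow A c.rep k ≤ LinearMap.ker f := by
  have hle := h.loewyLength_le c d hcd
  by_cases hs : Function.Surjective f
  · obtain hl | hl := hle.eq_or_lt
    · obtain ⟨S, hc, hd⟩ := h.exists_bottomLayer c d hcd hl
      exact Or.inl ((bijective_or_isRadicalMap_of_surjective c.isIndecomposable_rep
        hs).resolve_right fun hf ↦ hc.2 d hd ⟨f, hf, hs⟩)
    · exact Or.inr (le_ker_of_loewyLength_le f (by omega))
  · exact Or.inr ((h.isLocal d).le_ker_of_not_surjective hs (by omega))

/-- Every summand has a reflection in a higher layer. -/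
theorem IsLayering.exists_reflection (h : IsLayering A lev) (c : IndecClass A N) :
    (∀ d, lev c ≤ lev d → ∀ f : c.rep →ₗ[A] d.rep, Function.Bijective f ∨ f = 0) ∨
    ∃ c', lev c < lev c' ∧ ∃ π : c.rep →ₗ[A] c'.rep, Function.Surjective π ∧
      ∀ d, lev c ≤ lev d → ∀ f : c.rep →ₗ[A] d.rep,
        Function.Bijective f ∨ ∃ g : c'.rep →ₗ[A] d.rep, f = g ∘ₗ π := by
  have := c.isIndecomposable_rep.1
  obtain ⟨k, hk⟩ : ∃ k, loewyLength A c.rep = k + 1 :=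
    ⟨_, (Nat.succ_pred_eq_of_pos loewyLength_pos).symm⟩
  rcases k with _ | k
  -- Loewy length one: the last nonzero radical power is all of `c.rep`, so the reflection is zero.
  · refine Or.inl fun d hd f ↦ (h.bijective_or_le_ker hd f hk).imp_right fun hf ↦ ?_
    exact LinearMap.ker_eq_top.1 (top_le_iff.1 hf)
  · obtain ⟨c', π, hπ, hker⟩ := h.exists_quotient c k (by omega)
    refine Or.inr ⟨c', ?_, π, hπ, fun d hd f ↦ (h.bijective_or_le_ker hd f hk).imp_right
      fun hf ↦ ?_⟩
    · by_contra! hlt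
      have h1 := h.loewyLength_le _ _ hlt
      have h2 : loewyLength A c'.rep ≤ k + 1 := by
        rw [← radPow_eq_bot_iff, ← map_radPow_of_surjective hπ, ← LinearMap.le_ker_iff_map, hker]
      omega
    · let ε := π.quotKerEquivOfSurjective hπ
      refine ⟨(LinearMap.ker π).liftQ f (hker ▸ hf) ∘ₗ ε.symm.toLinearMap, ?_⟩
      ext x
      have : ε.symm (π x) = Submodule.Quotient.mk x := by
        rw [LinearEquiv.symm_apply_eq]
        rfl
      simp [this]

end Factor

/-! ### Matrix entries in the endomorphism ring of a direct sum. -/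

section Matrix

variable {A : Type u} [Ring A] {F : Type v} (X : F → Type v) [∀ x, AddCommGroup (X x)]
  [∀ x, Module A (X x)]

open Classical in
/-- The endomorphism of a direct sum with the single entry `g`. -/
def entry {x y : F} (g : X x →ₗ[A] X y) : Module.End A (⨁ x, X x) :=
  DirectSum.lof A F X y ∘ₗ g ∘ₗ DirectSum.component A F X x

variable {X}

theorem entry_mul_entry {x y z : F} (g : X y →ₗ[A] X z) (f : X x →ₗ[A] X y) :
    entry X g * entry X f = entry X (g ∘ₗ f) := by
  refine LinearMap.ext fun v ↦ ?_
  simp only [entry, Module.End.mul_apply, LinearMap.comp_apply, DirectSum.component.lof_self]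

theorem entry_mul_entry_of_ne {x y y' z : F} (h : y ≠ y') (g : X y' →ₗ[A] X z)
    (f : X x →ₗ[A] X y) : entry X g * entry X f = 0 := by
  refine LinearMap.ext fun v ↦ ?_
  simp only [entry, Module.End.mul_apply, LinearMap.comp_apply, DirectSum.component.of, dif_neg h,
    map_zero, LinearMap.zero_apply]

theorem entry_zero {x y : F} : entry X (0 : X x →ₗ[A] X y) = 0 := by
  simp [entry]

theorem completeOrthogonalIdempotents_entry [Fintype F] :
    CompleteOrthogonalIdempotents fun x : F ↦ entry X (LinearMap.id : X x →ₗ[A] X x) where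
  idem x := entry_mul_entry _ _
  ortho x y hxy := entry_mul_entry_of_ne hxy.symm _ _
  complete := by
    classical
    refine LinearMap.ext fun v ↦ DirectSum.ext_component A fun y ↦ ?_
    rw [LinearMap.sum_apply, map_sum, Finset.sum_eq_single y]
    · simp only [entry, LinearMap.comp_apply, DirectSum.component.lof_self, LinearMap.id_apply,
        Module.End.one_apply]
    · intro x _ hxy
      simp only [entry, LinearMap.comp_apply, DirectSum.component.of, dif_neg hxy]
    · simp

theorem exists_entry (x y : F) (b : Module.End A (⨁ x, X x)) :
    ∃ g : X x →ₗ[A] X y, entry X (LinearMap.id : X y →ₗ[A] X y) * b *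
      entry X (LinearMap.id : X x →ₗ[A] X x) = entry X g := by
  classical
  refine ⟨DirectSum.component A F X y ∘ₗ b ∘ₗ DirectSum.lof A F X x, LinearMap.ext fun v ↦ ?_⟩
  simp only [entry, Module.End.mul_apply, LinearMap.comp_apply, LinearMap.id_apply]

/-- A surjection is right cancellable; this gives `cancel` in `IsLayered`. -/
theorem mul_entry_id_eq_zero {x y : F} {π : X x →ₗ[A] X y} (hπ : Function.Surjective π)
    {b : Module.End A (⨁ x, X x)} (hb : b * entry X π = 0) :
    b * entry X (LinearMap.id : X y →ₗ[A] X y) = 0 := by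
  classical
  refine LinearMap.ext fun v ↦ ?_
  obtain ⟨w, hw⟩ := hπ (DirectSum.component A F X y v)
  have := LinearMap.congr_fun hb (DirectSum.lof A F X x w)
  simp only [entry, Module.End.mul_apply, LinearMap.comp_apply, LinearMap.zero_apply] at this
  simp only [entry, Module.End.mul_apply, LinearMap.comp_apply, LinearMap.id_apply,
    LinearMap.zero_apply, ← hw]
  rw [← this]
  congr!
  exact (DirectSum.component.lof_self ..).symm

end Matrix

/-! ### From reflections to layered idempotents. -/

section Layered

variable {A : Type u} [Ring A] [IsSemiprimaryRing A] {N : Type v} [AddCommGroup N] [Module A N]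
  [IsNoetherian A N] [IsArtinian A N] [Fintype (IndecClass A N)] {lev : IndecClass A N → ℕ}

theorem IsLayering.exists_isLayered (h : IsLayering A lev) :
    ∃ η f : IndecClass A N → Module.End A (Basic A N), IsLayered
      (fun c ↦ entry (fun c : IndecClass A N ↦ c.rep) (LinearMap.id : c.rep →ₗ[A] c.rep))
      lev η f := by
  set E := fun c : IndecClass A N ↦
    entry (fun c : IndecClass A N ↦ c.rep) (LinearMap.id : c.rep →ₗ[A] c.rep) with hE
  -- Distinct classes have non-isomorphic representatives, so a bijection forces `d = c`.
  have hiso {c d : IndecClass A N} {g : c.rep →ₗ[A] d.rep} (hg : Function.Bijective g) :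
      d = c ∧ ∃ b, b * entry (fun c : IndecClass A N ↦ c.rep) g = E c ∧
        entry (fun c : IndecClass A N ↦ c.rep) g * b = E c := by
    let ε := LinearEquiv.ofBijective g hg
    have hcd := IndecClass.eq_of_equiv ε
    refine ⟨hcd.symm, entry (fun c : IndecClass A N ↦ c.rep) ε.symm.toLinearMap, ?_, ?_⟩
    · rw [entry_mul_entry]
      congr 1
      ext x
      exact congr_arg _ (ε.symm_apply_apply x)
    · rw [entry_mul_entry]
      have : E c = E d := by rw [hcd]
      rw [this]
      congr 1
      ext x
      exact congr_arg _ (ε.apply_symm_apply x)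
  have key (c : IndecClass A N) : ∃ η f, (f = 0 ∨ ∃ y, lev c < lev y ∧ f = E y) ∧ f * η = η ∧
      η * E c = η ∧ (∀ b, b * η = 0 → b * f = 0) ∧ ∀ y b, lev c ≤ lev y → E y * b * E c = b →
        (y = c ∧ ∃ a, a * b = E c ∧ b * a = E c) ∨ ∃ a, b = a * η := by
    obtain h0 | ⟨c', hc', π, hπ, hfac⟩ := h.exists_reflection c
    · refine ⟨0, 0, Or.inl rfl, by simp, by simp, by simp, fun y b hy hb ↦ ?_⟩
      obtain ⟨g, hg⟩ := exists_entry (X := fun c : IndecClass A N ↦ c.rep) c y b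
      obtain rfl := hb.symm.trans hg
      obtain hg | rfl := h0 y hy g
      · exact Or.inl (hiso hg)
      · exact Or.inr ⟨0, by rw [entry_zero, mul_zero]⟩
    · refine ⟨entry _ π, E c', Or.inr ⟨c', hc', rfl⟩, entry_mul_entry _ _, entry_mul_entry _ _,
        fun b hb ↦ mul_entry_id_eq_zero hπ hb, fun y b hy hb ↦ ?_⟩
      obtain ⟨g, hg⟩ := exists_entry (X := fun c : IndecClass A N ↦ c.rep) c y b
      obtain rfl := hb.symm.trans hg
      obtain hg | ⟨g', rfl⟩ := hfac y hy g
      · exact Or.inl (hiso hg)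
      · exact Or.inr ⟨entry (fun c : IndecClass A N ↦ c.rep) g',
          (entry_mul_entry (X := fun c : IndecClass A N ↦ c.rep) g' π).symm⟩
  choose η f h1 h2 h3 h4 h5 using key
  exact ⟨η, f, { completeOrthogonalIdempotents_entry with
    corner := h1
    corner_mul := h2
    mul_idem := h3
    cancel := h4
    factor := h5 }⟩

end Layered

/-! ### The layering of `F` and finiteness of the endomorphism algebra. -/

section ADRAlgebra

variable {A : Type u} [Ring A] [IsArtinianRing A] {M : Type v} [AddCommGroup M] [Module A M]
  [Module.Finite A M]

theorem IsSemilocalModule.isLayering (hM : IsSemilocalModule A M) :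
    IsLayering A (N := RadQuotientSum A M) layerIndex := by
  have := hM.finite_summands
  have : IsNoetherian A (RadQuotientSum A M) := inferInstance
  have : IsArtinian A (RadQuotientSum A M) := inferInstance
  have hle := hM.loewyLength_rep_le
  exact
    { isLocal := hM.isLocalModule_rep
      loewyLength_le := fun c d hcd ↦ by
        by_contra! h
        exact hcd.not_gt (layerIndex_lt_of_loewyLength_lt (hle d) h)
      exists_bottomLayer := fun c d ↦ exists_bottomLayer_of_layerIndex_le (hle c) (hle d)
      exists_quotient := fun c j ↦ hM.exists_quotient_summand c }

theorem IsSemilocalModule.layerIndex_lt (hM : IsSemilocalModule A M) (c : Summands A M) :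
    layerIndex c < layerNumber A M := by
  have := hM.finite_summands
  have : IsNoetherian A (RadQuotientSum A M) := inferInstance
  have : IsArtinian A (RadQuotientSum A M) := inferInstance
  refine layerIndex_lt_sum (hM.loewyLength_rep_le c) ?_
  have := c.isIndecomposable_rep.1
  have h1 : 0 < loewyLength A c.rep := loewyLength_pos
  have h2 := hM.loewyLength_rep_le c
  omega

omit [IsArtinianRing A] in
theorem finite_moduleEnd (R : Type*) [CommRing R] [IsNoetherianRing R] [Algebra R A]
    (X : Type v) [AddCommGroup X] [Module A X] [Module R X] [IsScalarTower R A X]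
    [Module.Finite A X] [Module.Finite R X] : Module.Finite R (Module.End A X) := by
  obtain ⟨n, s, hs⟩ := Module.Finite.exists_fin (R := A) (M := X)
  let T : Module.End A X →ₗ[R] (Fin n → X) :=
    { toFun := fun g i ↦ g (s i)
      map_add' := fun _ _ ↦ rfl
      map_smul' := fun _ _ ↦ rfl }
  exact Module.Finite.of_injective T fun g g' h ↦
    LinearMap.ext_on_range hs fun i ↦ congr_fun h i

omit [IsArtinianRing A] in
-- Being finite over the commutative artinian ring `R` is a left-right symmetric condition, so the
-- endomorphism ring and its opposite are both artinian.
theorem isSemiprimaryRing_moduleEnd (R : Type*) [CommRing R] [IsArtinianRing R] [Algebra R A]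
    [Module.Finite R A] (X : Type v) [AddCommGroup X] [Module A X] [Module.Finite A X] :
    IsSemiprimaryRing (Module.End A X) ∧ IsSemiprimaryRing (Module.End A X)ᵐᵒᵖ := by
  let _ : Module R X := Module.compHom X (algebraMap R A)
  have : IsScalarTower R A X := ⟨fun r a x ↦ by
    change (r • a) • x = algebraMap R A r • a • x
    rw [Algebra.smul_def, mul_smul]⟩
  have := Module.Finite.trans (R := R) A X
  have := finite_moduleEnd (A := A) R X
  have h1 := IsArtinianRing.of_finite R (Module.End A X)
  have h2 := IsArtinianRing.of_finite R (Module.End A X)ᵐᵒᵖ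
  exact ⟨inferInstance, inferInstance⟩

end ADRAlgebra

end ADR

end

theorem mainTheorem3 {R : Type*} [CommRing R] [IsArtinianRing R] {A : Type*} [Ring A]
    [Algebra R A] [Module.Finite R A] {M : Type*} [AddCommGroup M] [Module A M]
    [Module.Finite A M] (hM : ADR.IsSemilocalModule A M) :
    ADR.leftGlobalDim (ADR.ADRAlgebra A M) ≤ (ADR.layerNumber A M : WithBot ℕ∞) ∧
      ADR.rightGlobalDim (ADR.ADRAlgebra A M) ≤ (ADR.layerNumber A M : WithBot ℕ∞) := by
  have : IsArtinianRing A := IsArtinianRing.of_finite R A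
  have := hM.finite_summands
  have := Fintype.ofFinite (ADR.Summands A M)
  have : IsNoetherian A (ADR.RadQuotientSum A M) := inferInstance
  have : IsArtinian A (ADR.RadQuotientSum A M) := inferInstance
  obtain ⟨η, f, h⟩ := hM.isLayering.exists_isLayered
  have : Module.Finite A (ADR.Tilde A M) := inferInstance
  obtain ⟨h₁, h₂⟩ := ADR.isSemiprimaryRing_moduleEnd (A := A) R (ADR.Tilde A M)
  exact ⟨h.leftGlobalDim_le hM.layerIndex_lt, h.op.leftGlobalDim_le hM.layerIndex_lt⟩
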